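/- Conventions: metrics have signature $(+---)$ on smooth 4-manifolds, all fields are smooth, $\nabla$ is the Levi-Civita connection, $(\nabla_i\nabla_j-\nabla_j\nabla_i)v^k=R_{ij}{}^k{}_l v^l$, $R_{jl}=R_{kj}{}^k{}_l$, $G_{ij}=R_{ij}-\tfrac12 R g_{ij}$, $L_{ij}=\tfrac12(R_{ij}-\tfrac16 R g_{ij})$, $L=g^{ij}L_{ij}$, $\square=g^{ij}\nabla_i\nabla_j$. For $\Lambda,\mu\in\mathbb R$ and $\epsilon\in\{1,-1\}$, a spacetime $(M,g)$ with a function $\phi$ and finitely many further matter components $a$ is called a solution with cosmological constant $\Lambda$, conformal scalar field $\phi$, parameter $\epsilon$ and quartic coefficient $\mu$ if $$\square\phi-L\phi=-4\mu\phi^3,\qquad G_{ij}+\Lambda g_{ij}=T^{[\phi]}_{ij}+\sum_a s_aT^{a}_{ij},$$ $$\epsilon T^{[\phi]}_{ij}=4\nabla_i\phi\nabla_j\phi-g_{ij}\nabla^k\phi\nabla_k\phi-2\phi\nabla_i\nabla_j\phi+2\phi^2L_{ij}-2\mu\phi^4g_{ij}.$$ Here $s_a=1$ if the component $a$ is attractive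 and $s_a=-1$ if it is repulsive, and $T^a_{ij}$ is symmetric, trace-free and divergence-free (minimal coupling). Each component has one of the following types: - Maxwell field: a closed two-form $F$ with $\nabla^iF_{ij}=0$ and $T_{ij}=F_{il}F^l{}_j+\tfrac14g_{ij}F_{kl}F^{kl}$; - Yang–Mills field of a compact gauge group with an invariant inner product on its Lie algebra: a connection with curvature $F$ satisfying $\nabla^iF_{ij}+[A^i,F_{ij}]=0$ and $T_{ij}=\langle F_{il},F^l{}_j\rangle+\tfrac14g_{ij}\langle F_{kl},F^{kl}\rangle$; - radiation fluid: $T_{ij}=\tfrac43\rho u_iu_j-\tfrac13\rho g_{ij}$ with $\rho\ge0$, $u^iu_i=1$; - null fluid: $T_{ij}=\rho k_ik_j$ with $\rho\ge0$ and $k$ a nowhere zero null covector; - massless Vlasov matter: a distribution function $f\ge0$ on the bundle of nonzero null covectors (the restriction of a function smooth off the zero section of the cotangent bundle), annihilated by the Hamiltonian vector field of $\tfrac12g^{ij}p_ip_j$, with $T_{ij}=\int f\,p_ip_j\,\frac{d^3q}{|q|}$ over the null cone, where $q\in\mathbb R^3$ are the spatial components of $p$ in an orthonormal coframe and the integral is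 assumed absolutely convergent; - other trace-free matter, described only by its tensor $T_{ij}$. **Theorem.** Let $(\hat M,\hat g)$ be a solution with cosmological constant $6\lambda$, conformal scalar field $\hat\phi$, parameter $\epsilon$, quartic coefficient $\mu$ and further trace-free matter components $\hat{\mathcal M}_a$ with tensors $\hat T^a_{ij}$. Put $\check M=\{x\in\hat M:\hat\phi(x)\neq0\}$, $\check g=\hat\phi^2\hat g$ and $\check\phi=1/\hat\phi$ on $\check M$. Then: 1. $(\check M,\check g)$ is a solution with cosmological constant $6\mu$, conformal scalar field $\check\phi$ and quartic coefficient $\lambda$, for suitable further matter components $\check{\mathcal M}_a$ with tensors $\check T^a_{ij}=\hat\phi^{-2}\hat T^a_{ij}$. 2. The parameter $\epsilon$ is the same for both solutions. 3. Each $\check{\mathcal M}_a$ is of the same type as $\hat{\mathcal M}_a$ (with the same gauge group and inner product in the Yang–Mills case). 4. If $\epsilon=1$, then $\check{\mathcal M}_a$ is attractive where $\hat{\mathcal M}_a$ is repulsive, and repulsive where $\hat{\mathcal M}_a$ is attractive. 5. If $\epsilon=-1$, then $\check{\mathcal M}_a$ and $\hat{\mathcal M}_a$ are both attractive or both repulsive.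 -/

import Mathlib

open scoped Manifold ContDiff Matrix

noncomputable section

namespace ConformalDuality

/-! ## Tensor calculus in coordinates

Coordinates take values in `V = ℝ⁴`.  Functions on `V` are used on open sets only, so `fderiv`
is the usual derivative. -/

/-- The coordinate space `ℝ⁴`. -/
abbrev V : Type := EuclideanSpace ℝ (Fin 4)

/-- Coordinate components of a covariant two-tensor, as functions of the point. -/
abbrev Comp2 : Type := V → Fin 4 → Fin 4 → ℝ

/-- The `i`-th coordinate vector of `ℝ⁴`. -/
def basisVec (i : Fin 4) : V := EuclideanSpace.single i (1 : ℝ)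

/-- The partial derivative `∂_i f`. -/
def pd {E : Type*} [NormedAddCommGroup E] [NormedSpace ℝ E] (i : Fin 4) (f : V → E) (y : V) : E :=
  fderiv ℝ f y (basisVec i)

/-- The components `g^{ij}` of the inverse metric. -/
def inv (g : Comp2) : Comp2 := fun y i j => ((Matrix.of (g y))⁻¹ : Matrix (Fin 4) (Fin 4) ℝ) i j

/-- The Christoffel symbols `Γ^k_{ij}` of the Levi-Civita connection. -/
def christoffel (g : Comp2) (y : V) (k i j : Fin 4) : ℝ :=
  (1 / 2) * ∑ l, inv g y k l *
    (pd i (fun z => g z j l) y + pd j (fun z => g z i l) y - pd l (fun z => g z i j) y)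

/-- The curvature `R_{ij}{}^k{}_l`, with `(∇_i ∇_j - ∇_j ∇_i) v^k = R_{ij}{}^k{}_l v^l`. -/
def riemann (g : Comp2) (y : V) (i j k l : Fin 4) : ℝ :=
  pd i (fun z => christoffel g z k j l) y - pd j (fun z => christoffel g z k i l) y
    + ∑ m, (christoffel g y k i m * christoffel g y m j l
      - christoffel g y k j m * christoffel g y m i l)

/-- The Ricci tensor `R_{jl} = R_{kj}{}^k{}_l`. -/
def ricci (g : Comp2) : Comp2 := fun y j l => ∑ k, riemann g y k j k l

/-- The metric trace `g^{ij} T_{ij}`. -/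
def trace (g T : Comp2) (y : V) : ℝ := ∑ i, ∑ j, inv g y i j * T y i j

/-- The Schouten tensor `L_{ij} = (R_{ij} - R g_{ij} / 6) / 2`. -/
def schouten (g : Comp2) : Comp2 := fun y i j =>
  (1 / 2) * (ricci g y i j - (1 / 6) * trace g (ricci g) y * g y i j)

/-- The Einstein tensor `G_{ij} = R_{ij} - R g_{ij} / 2`. -/
def einstein (g : Comp2) : Comp2 := fun y i j =>
  ricci g y i j - (1 / 2) * trace g (ricci g) y * g y i j

/-- The Hessian `∇_i ∇_j φ`. -/
def hessian (g : Comp2) (φ : V → ℝ) : Comp2 := fun y i j =>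
  pd i (fun z => pd j φ z) y - ∑ k, christoffel g y k i j * pd k φ y

/-- The d'Alembertian `□ φ = g^{ij} ∇_i ∇_j φ`. -/
def box (g : Comp2) (φ : V → ℝ) (y : V) : ℝ := trace g (hessian g φ) y

/-- The squared gradient `∇^k φ ∇_k φ`. -/
def gradSq (g : Comp2) (φ : V → ℝ) (y : V) : ℝ := ∑ i, ∑ j, inv g y i j * pd i φ y * pd j φ y

/-- The tensor `4 ∇_i φ ∇_j φ - g_{ij} ∇^k φ ∇_k φ - 2 φ ∇_i ∇_j φ + 2 φ² L_{ij} - 2 μ φ⁴ g_{ij}`. -/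
def scalarD (g : Comp2) (φ : V → ℝ) (μ : ℝ) : Comp2 := fun y i j =>
  4 * pd i φ y * pd j φ y - g y i j * gradSq g φ y - 2 * φ y * hessian g φ y i j
    + 2 * φ y ^ 2 * schouten g y i j - 2 * μ * φ y ^ 4 * g y i j

/-- The covariant derivative `∇_k T_{ij}` of a two-tensor with values in `E`. -/
def covDeriv {E : Type*} [NormedAddCommGroup E] [NormedSpace ℝ E] (g : Comp2)
    (T : V → Fin 4 → Fin 4 → E) (y : V) (k i j : Fin 4) : E :=
  pd k (fun z => T z i j) y
    - ∑ m, (christoffel g y m k i • T y m j + christoffel g y m k j • T y i m)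

/-- The divergence `∇^i T_{ij} = g^{ki} ∇_k T_{ij}`. -/
def divergence {E : Type*} [NormedAddCommGroup E] [NormedSpace ℝ E] (g : Comp2)
    (T : V → Fin 4 → Fin 4 → E) (y : V) (j : Fin 4) : E :=
  ∑ k, ∑ i, inv g y k i • covDeriv g T y k i j

/-- The Minkowski matrix of signature `(+ - - -)`. -/
def eta : Matrix (Fin 4) (Fin 4) ℝ := Matrix.diagonal ![1, -1, -1, -1]

/-- The rows of `P` are the components of an orthonormal coframe at `y`:
`g_{ij} = η_{ab} P^a_i P^b_j`. -/
def IsOrthonormalCoframe (g : Comp2) (y : V) (P : Matrix (Fin 4) (Fin 4) ℝ) : Prop :=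
  IsUnit P.det ∧ Matrix.of (g y) = Pᵀ * eta * P

/-! ## Fields on a smooth four-manifold -/

section Fields

variable (M : Type*) [TopologicalSpace M] [ChartedSpace V M]

/-- Covariant two-tensor fields. -/
abbrev Tensor2 : Type _ :=
  ∀ x : M, TangentSpace (𝓡 4) x →ₗ[ℝ] TangentSpace (𝓡 4) x →ₗ[ℝ] ℝ

/-- Covector fields. -/
abbrev Covector : Type _ := ∀ x : M, TangentSpace (𝓡 4) x →ₗ[ℝ] ℝ

/-- Vector fields. -/
abbrev VectorField : Type _ := ∀ x : M, TangentSpace (𝓡 4) x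

variable {M}

/-- The smooth charts of `M`. -/
def IsChart (e : OpenPartialHomeomorph M V) : Prop :=
  e ∈ IsManifold.maximalAtlas (𝓡 4) ∞ M

/-- The image of `U` in the chart `e`. -/
def chartImage (e : OpenPartialHomeomorph M V) (U : Set M) : Set V := e.target ∩ e.symm ⁻¹' U

/-- The coordinate vector `∂_i` at the point with coordinates `y`. -/
def coordVec (e : OpenPartialHomeomorph M V) (y : V) (i : Fin 4) :
    TangentSpace (𝓡 4) (e.symm y) :=
  mfderiv (𝓡 4) (𝓡 4) e.symm y (basisVec i)

/-- The coordinate covector `dy^i` at `x`. -/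
def coordCovec (e : OpenPartialHomeomorph M V) (x : M) (i : Fin 4) :
    TangentSpace (𝓡 4) x →ₗ[ℝ] ℝ :=
  (EuclideanSpace.proj i : V →L[ℝ] ℝ).toLinearMap ∘ₗ
    (mfderiv (𝓡 4) (𝓡 4) e x).toLinearMap

/-- The components `T_{ij}` in the chart `e`. -/
def comp2 (e : OpenPartialHomeomorph M V) (T : Tensor2 M) : Comp2 := fun y i j =>
  T (e.symm y) (coordVec e y i) (coordVec e y j)

/-- The components `w_i` of a covector field. -/
def compCovec (e : OpenPartialHomeomorph M V) (w : Covector M) (y : V) (i : Fin 4) : ℝ :=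
  w (e.symm y) (coordVec e y i)

/-- The components `v^i` of a vector field. -/
def compVec (e : OpenPartialHomeomorph M V) (v : VectorField M) (y : V) (i : Fin 4) : ℝ :=
  coordCovec e (e.symm y) i (v (e.symm y))

/-- A function in the chart `e`. -/
def rep {E : Type*} (e : OpenPartialHomeomorph M V) (f : M → E) : V → E := fun y => f (e.symm y)

/-- Smoothness on `U` of a function. -/
def SmoothFun (U : Set M) (f : M → ℝ) : Prop :=
  ∀ e, IsChart e → ContDiffOn ℝ ∞ (rep e f) (chartImage e U)

/-- Smoothness on `U` of a two-tensor field. -/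
def SmoothTensor2 (U : Set M) (T : Tensor2 M) : Prop :=
  ∀ e, IsChart e → ∀ i j, ContDiffOn ℝ ∞ (fun y => comp2 e T y i j) (chartImage e U)

/-- `g` is a smooth metric of signature `(+ - - -)` on `U`. -/
def IsLorentzMetric (U : Set M) (g : Tensor2 M) : Prop :=
  SmoothTensor2 U g ∧
    ∀ e, IsChart e → ∀ y ∈ chartImage e U, ∃ P, IsOrthonormalCoframe (comp2 e g) y P

end Fields

/-! ## Types of trace-free matter -/

/-- A compact gauge group, given as a closed group of unitary matrices, with an invariant inner
product on its Lie algebra. -/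
structure GaugeGroup where
  /-- size of the matrices -/
  N : ℕ
  /-- the group -/
  K : Subgroup (Matrix.unitaryGroup (Fin N) ℂ)
  isClosed : IsClosed (K : Set (Matrix.unitaryGroup (Fin N) ℂ))
  /-- the inner product; only its values on the Lie algebra of `K` matter -/
  form : Matrix (Fin N) (Fin N) ℂ →ₗ[ℝ] Matrix (Fin N) (Fin N) ℂ →ₗ[ℝ] ℝ
  form_symm : ∀ X Y, form X Y = form Y X
  form_pos : ∀ X, (∀ t : ℝ, ∃ u ∈ K, (u : Matrix (Fin N) (Fin N) ℂ) = NormedSpace.exp (t • X)) →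
    X ≠ 0 → 0 < form X X
  form_invariant : ∀ u ∈ K, ∀ X Y,
    (∀ t : ℝ, ∃ w ∈ K, (w : Matrix (Fin N) (Fin N) ℂ) = NormedSpace.exp (t • X)) →
    (∀ t : ℝ, ∃ w ∈ K, (w : Matrix (Fin N) (Fin N) ℂ) = NormedSpace.exp (t • Y)) →
    form ((u : Matrix (Fin N) (Fin N) ℂ) * X * ((u⁻¹ : Matrix.unitaryGroup (Fin N) ℂ) :
        Matrix (Fin N) (Fin N) ℂ))
      ((u : Matrix (Fin N) (Fin N) ℂ) * Y * ((u⁻¹ : Matrix.unitaryGroup (Fin N) ℂ) :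
        Matrix (Fin N) (Fin N) ℂ)) = form X Y

/-- The matrices on which the gauge fields take values. -/
abbrev GaugeGroup.Mat (𝒢 : GaugeGroup) : Type := Matrix (Fin 𝒢.N) (Fin 𝒢.N) ℂ

/-- The Lie algebra of the gauge group. -/
def GaugeGroup.lieAlg (𝒢 : GaugeGroup) : Set 𝒢.Mat :=
  {X | ∀ t : ℝ, ∃ u ∈ 𝒢.K, (u : 𝒢.Mat) = NormedSpace.exp (t • X)}

/-- The partial derivative of a matrix-valued function, entry by entry. -/
def pdMat {n : ℕ} (i : Fin 4) (A : V → Matrix (Fin n) (Fin n) ℂ) (y : V) :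
    Matrix (Fin n) (Fin n) ℂ :=
  Matrix.of fun a b => pd i (fun z => A z a b) y

/-- The divergence `∇^i F_{ij}` of a matrix-valued two-tensor, entry by entry. -/
def divMat {n : ℕ} (g : Comp2) (F : V → Fin 4 → Fin 4 → Matrix (Fin n) (Fin n) ℂ) (y : V)
    (j : Fin 4) : Matrix (Fin n) (Fin n) ℂ :=
  Matrix.of fun a b => divergence g (fun z k l => F z k l a b) y j

/-- The types of trace-free matter.  `other` stands for trace-free matter that is described by
nothing but its energy-momentum tensor. -/
inductive MatterType : Type
  | maxwell
  | yangMills (𝒢 : GaugeGroup)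
  | radiationFluid
  | nullFluid
  | masslessVlasov
  | other

section Matter

variable (M : Type*) [TopologicalSpace M] [ChartedSpace V M]

/-- A connection on a principal bundle over (part of) `M`, in local form.  Around each point `x`
there is a patch `patch x` with a gauge potential `A x`; `γ x x'` is the transition function from
the gauge on `patch x` to the gauge on `patch x'`. -/
structure YangMillsField (𝒢 : GaugeGroup) where
  /-- the patches -/
  patch : M → Set M
  /-- the gauge potentials -/
  A : M → ∀ z : M, TangentSpace (𝓡 4) z →ₗ[ℝ] 𝒢.Mat
  /-- the transition functions -/
  γ : M → M → M → Matrix.unitaryGroup (Fin 𝒢.N) ℂ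

/-- A fluid: density and velocity vector. -/
structure FluidField where
  /-- the density -/
  ρ : M → ℝ
  /-- the velocity -/
  u : VectorField M

/-- A null fluid: density and null covector. -/
structure NullFluidField where
  /-- the density -/
  ρ : M → ℝ
  /-- the null direction -/
  k : Covector M

/-- The fields that describe matter of a given type.  Maxwell: the field strength `F`.  Vlasov: the
distribution function on the cotangent bundle (only its values at null covectors matter). -/
def MatterField : MatterType → Type _
  | .maxwell => Tensor2 M
  | .yangMills 𝒢 => YangMillsField M 𝒢
  | .radiationFluid => FluidField M
  | .nullFluid => NullFluidField M
  | .masslessVlasov => ∀ x : M, (TangentSpace (𝓡 4) x →ₗ[ℝ] ℝ) → ℝ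
  | .other => PUnit

variable {M}

/-- Maxwell's equations `F_{ij} = -F_{ji}`, `∂_{[i} F_{jk]} = 0`, `∇^i F_{ij} = 0` on `U`, and
`T_{ij} = F_{il} F^l{}_j + g_{ij} F_{kl} F^{kl} / 4`. -/
def MaxwellEquations (U : Set M) (g : Tensor2 M) (F T : Tensor2 M) : Prop :=
  SmoothTensor2 U F ∧
  ∀ e, IsChart e → ∀ y ∈ chartImage e U,
    (∀ i j, comp2 e F y i j = - comp2 e F y j i) ∧
    (∀ i j k, pd i (fun z => comp2 e F z j k) y + pd j (fun z => comp2 e F z k i) y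
      + pd k (fun z => comp2 e F z i j) y = 0) ∧
    (∀ j, divergence (comp2 e g) (comp2 e F) y j = 0) ∧
    (∀ i j, comp2 e T y i j =
      (∑ l, ∑ m, inv (comp2 e g) y l m * comp2 e F y i l * comp2 e F y m j)
      + (1 / 4) * comp2 e g y i j * ∑ k, ∑ l, ∑ m, ∑ n,
        inv (comp2 e g) y k m * inv (comp2 e g) y l n * comp2 e F y k l * comp2 e F y m n)

/-- The components `A_i` of a gauge potential in the chart `e`. -/
def YangMillsField.potential {𝒢 : GaugeGroup} (W : YangMillsField M 𝒢)
    (e : OpenPartialHomeomorph M V) (x : M) (y : V) (i : Fin 4) : 𝒢.Mat :=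
  W.A x (e.symm y) (coordVec e y i)

/-- The field strength `F_{ij} = ∂_i A_j - ∂_j A_i + [A_i, A_j]`. -/
def YangMillsField.strength {𝒢 : GaugeGroup} (W : YangMillsField M 𝒢)
    (e : OpenPartialHomeomorph M V) (x : M) (y : V) (i j : Fin 4) : 𝒢.Mat :=
  pdMat i (fun z => W.potential e x z j) y - pdMat j (fun z => W.potential e x z i) y
    + (W.potential e x y i * W.potential e x y j - W.potential e x y j * W.potential e x y i)

/-- `W` is a smooth connection over `U`, written in local gauges. -/
structure YangMillsField.IsConnection {𝒢 : GaugeGroup} (W : YangMillsField M 𝒢) (U : Set M) :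
    Prop where
  isOpen_patch : ∀ x ∈ U, IsOpen (W.patch x)
  mem_patch : ∀ x ∈ U, x ∈ W.patch x
  smooth_A : ∀ x ∈ U, ∀ e, IsChart e → ∀ i a b,
    ContDiffOn ℝ ∞ (fun y => W.potential e x y i a b) (chartImage e (W.patch x ∩ U))
  A_mem : ∀ x ∈ U, ∀ z ∈ W.patch x ∩ U, ∀ v, W.A x z v ∈ 𝒢.lieAlg
  smooth_γ : ∀ x ∈ U, ∀ x' ∈ U, ∀ e, IsChart e → ∀ a b,
    ContDiffOn ℝ ∞ (fun y => (W.γ x x' (e.symm y) : 𝒢.Mat) a b)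
      (chartImage e (W.patch x ∩ W.patch x' ∩ U))
  γ_mem : ∀ x ∈ U, ∀ x' ∈ U, ∀ z ∈ W.patch x ∩ W.patch x' ∩ U, W.γ x x' z ∈ 𝒢.K
  cocycle : ∀ x ∈ U, ∀ x' ∈ U, ∀ x'' ∈ U, ∀ z ∈ W.patch x ∩ W.patch x' ∩ W.patch x'' ∩ U,
    W.γ x x' z * W.γ x' x'' z = W.γ x x'' z
  /-- `A' = γ⁻¹ A γ + γ⁻¹ dγ` -/
  gauge : ∀ x ∈ U, ∀ x' ∈ U, ∀ e, IsChart e →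
    ∀ y ∈ chartImage e (W.patch x ∩ W.patch x' ∩ U), ∀ i,
      W.potential e x' y i =
        (((W.γ x x' (e.symm y))⁻¹ : Matrix.unitaryGroup (Fin 𝒢.N) ℂ) : 𝒢.Mat)
          * (W.potential e x y i * (W.γ x x' (e.symm y) : 𝒢.Mat)
            + pdMat i (fun z => (W.γ x x' (e.symm z) : 𝒢.Mat)) y)

/-- The Yang-Mills equations `∇^i F_{ij} + [A^i, F_{ij}] = 0` on `U`, and
`T_{ij} = ⟨F_{il}, F^l{}_j⟩ + g_{ij} ⟨F_{kl}, F^{kl}⟩ / 4`. -/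
def YangMillsEquations {𝒢 : GaugeGroup} (U : Set M) (g : Tensor2 M) (W : YangMillsField M 𝒢)
    (T : Tensor2 M) : Prop :=
  W.IsConnection U ∧
  ∀ x ∈ U, ∀ e, IsChart e → ∀ y ∈ chartImage e (W.patch x ∩ U),
    (∀ j, divMat (comp2 e g) (W.strength e x) y j
      + ∑ k, ∑ i, inv (comp2 e g) y k i •
        (W.potential e x y k * W.strength e x y i j
          - W.strength e x y i j * W.potential e x y k) = 0) ∧
    (∀ i j, comp2 e T y i j =
      (∑ l, ∑ m, inv (comp2 e g) y l m * 𝒢.form (W.strength e x y i l) (W.strength e x y m j))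
      + (1 / 4) * comp2 e g y i j * ∑ k, ∑ l, ∑ m, ∑ n,
        inv (comp2 e g) y k m * inv (comp2 e g) y l n
          * 𝒢.form (W.strength e x y k l) (W.strength e x y m n))

/-- A radiation fluid: `ρ ≥ 0`, `u^i u_i = 1` and `T_{ij} = 4 ρ u_i u_j / 3 - ρ g_{ij} / 3`.
(The Euler equations are the vanishing of the divergence of `T`.) -/
def RadiationFluidEquations (U : Set M) (g : Tensor2 M) (m : FluidField M) (T : Tensor2 M) :
    Prop :=
  SmoothFun U m.ρ ∧
  (∀ e, IsChart e → ∀ i, ContDiffOn ℝ ∞ (fun y => compVec e m.u y i) (chartImage e U)) ∧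
  ∀ x ∈ U, 0 ≤ m.ρ x ∧ g x (m.u x) (m.u x) = 1 ∧
    ∀ v w, T x v w = 4 / 3 * m.ρ x * g x (m.u x) v * g x (m.u x) w - 1 / 3 * m.ρ x * g x v w

/-- A null fluid: `ρ ≥ 0`, `k` a null covector without zeros, `T_{ij} = ρ k_i k_j`. -/
def NullFluidEquations (U : Set M) (g : Tensor2 M) (m : NullFluidField M) (T : Tensor2 M) :
    Prop :=
  SmoothFun U m.ρ ∧
  (∀ e, IsChart e → ∀ i, ContDiffOn ℝ ∞ (fun y => compCovec e m.k y i) (chartImage e U)) ∧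
  (∀ e, IsChart e → ∀ y ∈ chartImage e U,
    ∑ i, ∑ j, inv (comp2 e g) y i j * compCovec e m.k y i * compCovec e m.k y j = 0) ∧
  ∀ x ∈ U, 0 ≤ m.ρ x ∧ m.k x ≠ 0 ∧ ∀ v w, T x v w = m.ρ x * m.k x v * m.k x w

/-- The distribution function in the coordinates `(y, p)` of the cotangent bundle. -/
def phaseRep (e : OpenPartialHomeomorph M V) (f : ∀ x : M, (TangentSpace (𝓡 4) x →ₗ[ℝ] ℝ) → ℝ)
    (y p : V) : ℝ :=
  f (e.symm y) (∑ i, p i • coordCovec e (e.symm y) i)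

/-- The null covector with components `σ |q|, q_1, q_2, q_3` in the coframe `P`. -/
def nullMomentum (P : Matrix (Fin 4) (Fin 4) ℝ) (σ : ℝ) (q : EuclideanSpace ℝ (Fin 3)) : V :=
  WithLp.toLp 2 fun i => σ * ‖q‖ * P 0 i + ∑ a : Fin 3, q a * P a.succ i

/-- The massless Vlasov equation on `U`: `f ≥ 0` and the Hamiltonian vector field of
`g^{ij} p_i p_j / 2` annihilates `f` on the null cone; and `T_{ij}` is the second moment
`∫ f p_i p_j d³q / |q|` over the null cone.  Both halves of the cone are included, so that no time
orientation is needed; for a gas of future-directed particles `f` vanishes on the past half. -/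
def VlasovEquations (U : Set M) (g : Tensor2 M)
    (f : ∀ x : M, (TangentSpace (𝓡 4) x →ₗ[ℝ] ℝ) → ℝ) (T : Tensor2 M) : Prop :=
  (∀ x ∈ U, ∀ p, 0 ≤ f x p) ∧
  ∀ e, IsChart e →
    ContDiffOn ℝ ∞ (fun z : V × V => phaseRep e f z.1 z.2) {z | z.1 ∈ chartImage e U ∧ z.2 ≠ 0} ∧
    ∀ y ∈ chartImage e U,
      (∀ p : V, p ≠ 0 → ∑ i, ∑ j, inv (comp2 e g) y i j * p i * p j = 0 →
        (∑ i, ∑ j, inv (comp2 e g) y i j * p j * pd i (fun z => phaseRep e f z p) y)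
          - (1 / 2) * ∑ k, ∑ i, ∑ j, pd k (fun z => inv (comp2 e g) z i j) y * p i * p j
            * pd k (fun q => phaseRep e f y q) p = 0) ∧
      ∀ P, IsOrthonormalCoframe (comp2 e g) y P →
        (∀ σ : ℝ, σ = 1 ∨ σ = -1 → MeasureTheory.Integrable
          fun q : EuclideanSpace ℝ (Fin 3) => phaseRep e f y (nullMomentum P σ q) * ‖q‖) ∧
        ∀ i j, comp2 e T y i j = ∫ q : EuclideanSpace ℝ (Fin 3),
          (phaseRep e f y (nullMomentum P 1 q) * nullMomentum P 1 q i * nullMomentum P 1 q j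
            + phaseRep e f y (nullMomentum P (-1) q) * nullMomentum P (-1) q i
              * nullMomentum P (-1) q j) / ‖q‖

/-- The equations special to matter of a given type: field equations and the expression of the
energy-momentum tensor `T`. -/
def TypeEquations (U : Set M) (g T : Tensor2 M) : (t : MatterType) → MatterField M t → Prop
  | .maxwell, m => MaxwellEquations U g m T
  | .yangMills _, m => YangMillsEquations U g m T
  | .radiationFluid, m => RadiationFluidEquations U g m T
  | .nullFluid, m => NullFluidEquations U g m T
  | .masslessVlasov, m => VlasovEquations U g m T
  | .other, _ => True

/-- `m` is a minimally coupled trace-free matter model of type `t` on `(U, g)` with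
energy-momentum tensor `T`. -/
structure IsTraceFreeMatter (U : Set M) (g : Tensor2 M) (t : MatterType) (m : MatterField M t)
    (T : Tensor2 M) : Prop where
  smooth : SmoothTensor2 U T
  symm : ∀ x ∈ U, ∀ v w, T x v w = T x w v
  traceFree : ∀ e, IsChart e → ∀ y ∈ chartImage e U, trace (comp2 e g) (comp2 e T) y = 0
  divFree : ∀ e, IsChart e → ∀ y ∈ chartImage e U, ∀ j,
    divergence (comp2 e g) (comp2 e T) y j = 0
  equations : TypeEquations U g T t m

end Matter

/-- Attractive matter enters the Einstein equations with energy-momentum tensor `T`, repulsive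
matter with `-T`. -/
inductive Character : Type
  | attractive
  | repulsive

/-- The sign with which matter enters the Einstein equations. -/
def Character.sign : Character → ℝ
  | .attractive => 1
  | .repulsive => -1

/-- `(U, g)` is a spacetime that satisfies the Einstein equations
`G_{ij} + Λ g_{ij} = T^φ_{ij} + ∑ₐ ± T^a_{ij}` with cosmological constant `Λ`, conformal scalar
field `φ` with parameter `ε` and quartic coefficient `μ`, so `ε T^φ_{ij} = scalarD` (and `ε = ±1`)
and `□ φ - L φ = -4 μ φ³`, and further trace-free matter with components `m a` of type `τ a`,
energy-momentum tensor `T a` and character `χ a`. -/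
structure IsSolution {M : Type*} [TopologicalSpace M] [ChartedSpace V M]
    {ι : Type*} [Fintype ι] (U : Set M) (g : Tensor2 M) (φ : M → ℝ) (ε Λ μ : ℝ)
    (τ : ι → MatterType) (m : ∀ a, MatterField M (τ a)) (T : ι → Tensor2 M) (χ : ι → Character) :
    Prop where
  isOpen : IsOpen U
  metric : IsLorentzMetric U g
  smooth_field : SmoothFun U φ
  param : ε = 1 ∨ ε = -1
  wave : ∀ e, IsChart e → ∀ y ∈ chartImage e U,
    box (comp2 e g) (rep e φ) y - trace (comp2 e g) (schouten (comp2 e g)) y * rep e φ y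
      = -4 * μ * rep e φ y ^ 3
  matter : ∀ a, IsTraceFreeMatter U g (τ a) (m a) (T a)
  /-- Since `ε = ±1`, the energy-momentum tensor of the scalar field is `ε * scalarD`. -/
  einstein_eq : ∀ e, IsChart e → ∀ y ∈ chartImage e U, ∀ i j,
    einstein (comp2 e g) y i j + Λ * comp2 e g y i j
      = ε * scalarD (comp2 e g) (rep e φ) μ y i j + ∑ a, (χ a).sign * comp2 e (T a) y i j

end ConformalDuality

end

open ConformalDuality

/-!
On the open set where `φ ≠ 0`, write `g' = φ² g` and let `L`, `L'` be the Schouten tensors of both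
metrics.  The transformation law of the Schouten tensor (`IsConformal.schouten_eq`, obtained from
the difference of the Levi-Civita connections) says that `scalarD g φ μ = 2 φ² L' - 2 μ φ² g'`
(`IsConformal.scalarD_eq`), and its trace says that `□ φ - (tr L) φ = -φ³ tr' L'`, where `tr` and
`tr'` are the metric traces for `g` and `g'` (`IsConformal.wave_eq`).  Hence the wave equation is the
statement `tr' L' = 4 μ`.  Since the scalar field and the matter have trace-free energy-momentum
tensors, the trace of the Einstein equations is `tr L = 4 λ`
(`IsConformal.trace_schouten_of_einstein`); because `g = (1 / φ)² g'`, this is the wave equation of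
`1 / φ` for the metric `g'`.  With these two constants the Einstein equations become
`2 L - 2 λ g = ε φ² (2 L' - 2 μ g') + ∑ ± T`.  Solved for `2 L' - 2 μ g'`, they have the same form,
with matter terms multiplied by `-ε φ⁻²`.  These are the dual Einstein equations, and the factor
`-ε` is the change of sign of the matter (`IsConformal.dual_einstein`).

The matter itself is conformally invariant in dimension four.  By `IsConformal.divergence_eq`, the
divergence of a two-form only acquires a factor, and a trace-free symmetric divergence-free tensor
remains so after multiplication by `φ⁻²`; each type of matter has a choice of weights for its fields
(`dualField`) which is compatible with this (`IsTraceFreeMatter.conformal`).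
-/

noncomputable section

namespace ConformalDuality

/-! ### Partial derivatives -/

section PartialDerivatives

variable {E : Type*} [NormedAddCommGroup E] [NormedSpace ℝ E]

lemma pd_congr {f f' : V → E} {y : V} (i : Fin 4) (h : f =ᶠ[nhds y] f') : pd i f y = pd i f' y := by
  unfold pd; rw [h.fderiv_eq]

lemma pd_congr_of_isOpen {f f' : V → E} {S : Set V} (hS : IsOpen S) (h : ∀ z ∈ S, f z = f' z)
    (i : Fin 4) {y : V} (hy : y ∈ S) : pd i f y = pd i f' y :=
  pd_congr i (Filter.eventuallyEq_of_mem (hS.mem_nhds hy) h)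

lemma pd_add {f f' : V → E} {y : V} (i : Fin 4) (hf : DifferentiableAt ℝ f y)
    (hf' : DifferentiableAt ℝ f' y) : pd i (fun z => f z + f' z) y = pd i f y + pd i f' y := by
  simp [pd, fderiv_fun_add hf hf']

lemma pd_sub {f f' : V → E} {y : V} (i : Fin 4) (hf : DifferentiableAt ℝ f y)
    (hf' : DifferentiableAt ℝ f' y) : pd i (fun z => f z - f' z) y = pd i f y - pd i f' y := by
  simp [pd, fderiv_fun_sub hf hf']

lemma pd_mul {f f' : V → ℝ} {y : V} (i : Fin 4) (hf : DifferentiableAt ℝ f y)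
    (hf' : DifferentiableAt ℝ f' y) :
    pd i (fun z => f z * f' z) y = pd i f y * f' y + f y * pd i f' y := by
  simp [pd, fderiv_fun_mul hf hf']; ring

lemma pd_const_mul (c : ℝ) {f : V → ℝ} {y : V} (i : Fin 4) (hf : DifferentiableAt ℝ f y) :
    pd i (fun z => c * f z) y = c * pd i f y := by
  simp [pd, fderiv_const_mul hf]

lemma pd_sum {ι : Type*} (s : Finset ι) {f : ι → V → E} {y : V} (i : Fin 4)
    (hf : ∀ a ∈ s, DifferentiableAt ℝ (f a) y) :
    pd i (fun z => ∑ a ∈ s, f a z) y = ∑ a ∈ s, pd i (f a) y := by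
  simp [pd, fderiv_fun_sum hf]

lemma pd_sq {f : V → ℝ} {y : V} (i : Fin 4) (hf : DifferentiableAt ℝ f y) :
    pd i (fun z => f z ^ 2) y = 2 * f y * pd i f y := by
  simp [pd, fderiv_fun_pow 2 hf]

lemma pd_inv {f : V → ℝ} {y : V} (i : Fin 4) (hf : DifferentiableAt ℝ f y) (h0 : f y ≠ 0) :
    pd i (fun z => (f z)⁻¹) y = -pd i f y / f y ^ 2 := by
  have h : fderiv ℝ (fun z => (f z)⁻¹) y = _ :=
    ((hasDerivAt_inv h0).comp_hasFDerivAt y hf.hasFDerivAt).fderiv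
  simp only [pd, h]
  simp; field_simp

lemma contDiffOn_pd {f : V → E} {S : Set V} (hS : IsOpen S) (hf : ContDiffOn ℝ ∞ f S)
    (i : Fin 4) : ContDiffOn ℝ ∞ (pd i f) S :=
  (hf.fderiv_of_isOpen hS (by simp)).clm_apply contDiffOn_const

lemma pd_comm {f : V → E} {S : Set V} (hS : IsOpen S) (hf : ContDiffOn ℝ ∞ f S) {y : V}
    (hy : y ∈ S) (i j : Fin 4) : pd i (pd j f) y = pd j (pd i f) y := by
  have hfy : ContDiffAt ℝ ∞ f y := hf.contDiffAt (hS.mem_nhds hy)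
  have hd : DifferentiableAt ℝ (fderiv ℝ f) y :=
    ((hf.fderiv_of_isOpen hS (m := ∞) (by simp)).contDiffAt (hS.mem_nhds hy)).differentiableAt
      (by simp)
  have htwo : minSmoothness ℝ 2 ≤ ∞ := by
    simpa using WithTop.coe_le_coe.2 (le_top : (2 : ℕ∞) ≤ ⊤)
  have hsymm := (hfy.isSymmSndFDerivAt htwo).eq (basisVec i) (basisVec j)
  have key : ∀ a b : Fin 4, pd a (pd b f) y
      = fderiv ℝ (fderiv ℝ f) y (basisVec a) (basisVec b) := by
    intro a b
    change fderiv ℝ (fun z => fderiv ℝ f z (basisVec b)) y (basisVec a) = _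
    rw [fderiv_clm_apply hd (differentiableAt_const _)]
    simp
  rw [key, key, hsymm]

end PartialDerivatives

/-! ### Metrics in coordinates -/

/-- The components of a smooth pseudo-Riemannian metric on the coordinate domain `S`. -/
structure IsMetricOn (S : Set V) (g : Comp2) : Prop where
  smooth : ∀ i j, ContDiffOn ℝ ∞ (fun y => g y i j) S
  symm : ∀ y ∈ S, ∀ i j, g y i j = g y j i
  isUnit_det : ∀ y ∈ S, IsUnit (Matrix.of (g y)).det

lemma contDiffOn_det {n : Type*} [Fintype n] [DecidableEq n] {S : Set V}
    {A : V → Matrix n n ℝ} (hA : ∀ i j, ContDiffOn ℝ ∞ (fun y => A y i j) S) :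
    ContDiffOn ℝ ∞ (fun y => (A y).det) S := by
  simp only [Matrix.det_apply']
  exact ContDiffOn.sum fun σ _ => contDiffOn_const.mul (contDiffOn_prod fun i _ => hA _ _)

namespace IsMetricOn

variable {S : Set V} {g : Comp2}

lemma contDiffOn_inv (hg : IsMetricOn S g) (i j : Fin 4) :
    ContDiffOn ℝ ∞ (fun y => inv g y i j) S := by
  have hdet := contDiffOn_det (A := fun y => Matrix.of (g y)) hg.smooth
  have hadj : ContDiffOn ℝ ∞ (fun y => (Matrix.of (g y)).adjugate i j) S := by
    simp only [Matrix.adjugate_apply]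
    refine contDiffOn_det fun a b => ?_
    by_cases h : a = j
    · subst h; simpa using contDiffOn_const
    · simpa [Matrix.updateRow_ne h] using hg.smooth a b
  refine ((hdet.inv fun y hy => (hg.isUnit_det y hy).ne_zero).mul hadj).congr fun y _ => ?_
  simp [inv, Matrix.inv_def, Ring.inverse_eq_inv]

lemma inv_mul (hg : IsMetricOn S g) {y : V} (hy : y ∈ S) (i j : Fin 4) :
    ∑ m, inv g y i m * g y m j = if i = j then 1 else 0 := by
  have := congrFun (congrFun (Matrix.nonsing_inv_mul _ (hg.isUnit_det y hy)) i) j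
  simpa [Matrix.mul_apply, Matrix.one_apply, inv] using this

lemma mul_inv (hg : IsMetricOn S g) {y : V} (hy : y ∈ S) (i j : Fin 4) :
    ∑ m, g y i m * inv g y m j = if i = j then 1 else 0 := by
  have := congrFun (congrFun (Matrix.mul_nonsing_inv _ (hg.isUnit_det y hy)) i) j
  simpa [Matrix.mul_apply, Matrix.one_apply, inv] using this

lemma inv_symm (hg : IsMetricOn S g) {y : V} (hy : y ∈ S) (i j : Fin 4) :
    inv g y i j = inv g y j i := by
  have h : (Matrix.of (g y))ᵀ = Matrix.of (g y) := by
    ext a b; simpa using hg.symm y hy b a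
  have := Matrix.transpose_nonsing_inv (Matrix.of (g y))
  rw [h] at this
  simpa [inv] using congrFun (congrFun this j) i

lemma contDiffOn_christoffel (hg : IsMetricOn S g) (hS : IsOpen S) (k i j : Fin 4) :
    ContDiffOn ℝ ∞ (fun y => christoffel g y k i j) S := by
  unfold christoffel
  exact contDiffOn_const.mul (ContDiffOn.sum fun l _ => (hg.contDiffOn_inv k l).mul
    (((contDiffOn_pd hS (hg.smooth _ _) _).add (contDiffOn_pd hS (hg.smooth _ _) _)).sub
      (contDiffOn_pd hS (hg.smooth _ _) _)))

lemma pd_symm (hg : IsMetricOn S g) (hS : IsOpen S) {y : V} (hy : y ∈ S) (k i j : Fin 4) :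
    pd k (fun z => g z i j) y = pd k (fun z => g z j i) y :=
  pd_congr_of_isOpen hS (fun z hz => hg.symm z hz i j) k hy

lemma christoffel_symm (hg : IsMetricOn S g) (hS : IsOpen S) {y : V} (hy : y ∈ S)
    (k i j : Fin 4) : christoffel g y k i j = christoffel g y k j i := by
  unfold christoffel
  congr 1
  refine Finset.sum_congr rfl fun l _ => ?_
  rw [hg.pd_symm hS hy l i j]; ring

/-- Lowering the upper index of the Christoffel symbols. -/
lemma sum_christoffel_mul (hg : IsMetricOn S g) {y : V} (hy : y ∈ S) (k i j : Fin 4) :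
    ∑ m, christoffel g y m k i * g y m j = (1 / 2) *
      (pd k (fun z => g z i j) y + pd i (fun z => g z k j) y - pd j (fun z => g z k i) y) := by
  have h : ∀ m, christoffel g y m k i * g y m j = ∑ l, (1 / 2) * ((g y j m * inv g y m l) *
      (pd k (fun z => g z i l) y + pd i (fun z => g z k l) y - pd l (fun z => g z k i) y)) := by
    intro m
    rw [christoffel, hg.symm y hy j m, mul_assoc, Finset.sum_mul, Finset.mul_sum]
    exact Finset.sum_congr rfl fun l _ => by ring
  simp_rw [h]
  rw [Finset.sum_comm]
  simp_rw [← Finset.mul_sum, ← Finset.sum_mul, hg.mul_inv hy]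
  simp

/-- The Levi-Civita connection is metric: `∂_k g_{ij} = Γ^m_{ki} g_{mj} + Γ^m_{kj} g_{im}`. -/
lemma pd_metric (hg : IsMetricOn S g) (hS : IsOpen S) {y : V} (hy : y ∈ S) (k i j : Fin 4) :
    pd k (fun z => g z i j) y =
      ∑ m, (christoffel g y m k i * g y m j + christoffel g y m k j * g y i m) := by
  have h : ∀ m, g y i m = g y m i := fun m => hg.symm y hy i m
  simp_rw [h, Finset.sum_add_distrib, hg.sum_christoffel_mul hy]
  rw [hg.pd_symm hS hy k j i]
  ring

end IsMetricOn

/-! ### Conformal changes of the metric -/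

/-- On the open set `S`, the metric `g'` is `φ² g`, where `φ` has no zeros. -/
structure IsConformal (S : Set V) (g g' : Comp2) (φ : V → ℝ) : Prop where
  isOpen : IsOpen S
  metric : IsMetricOn S g
  metric' : IsMetricOn S g'
  smooth : ContDiffOn ℝ ∞ φ S
  ne_zero : ∀ y ∈ S, φ y ≠ 0
  eq : ∀ y ∈ S, ∀ i j, g' y i j = φ y ^ 2 * g y i j

/-- The components of `d log |φ|`. -/
def logGrad (φ : V → ℝ) (i : Fin 4) (y : V) : ℝ := (φ y)⁻¹ * pd i φ y

/-- The components of the gradient vector of `log |φ|`. -/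
def logGradVec (g : Comp2) (φ : V → ℝ) (k : Fin 4) (y : V) : ℝ :=
  ∑ l, inv g y k l * logGrad φ l y

/-- The difference of the Levi-Civita connections of `φ² g` and `g`. -/
def connectionDiff (g : Comp2) (φ : V → ℝ) (y : V) (k i j : Fin 4) : ℝ :=
  (if k = j then 1 else 0) * logGrad φ i y + (if k = i then 1 else 0) * logGrad φ j y
    - logGradVec g φ k y * g y i j

/-- The covariant derivative `∇_i w_j` of `w = d log |φ|`. -/
def logHess (g : Comp2) (φ : V → ℝ) : Comp2 := fun y i j =>
  pd i (logGrad φ j) y - ∑ m, christoffel g y m i j * logGrad φ m y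

namespace IsConformal

variable {S : Set V} {g g' : Comp2} {φ : V → ℝ}

/-- The duality is an involution: `g` arises from `φ² g` by means of `1 / φ`. -/
lemma symm (h : IsConformal S g g' φ) : IsConformal S g' g (fun y => 1 / φ y) where
  isOpen := h.isOpen
  metric := h.metric'
  metric' := h.metric
  smooth := contDiffOn_const.div h.smooth h.ne_zero
  ne_zero y hy := one_div_ne_zero (h.ne_zero y hy)
  eq y hy i j := by rw [h.eq y hy]; have := h.ne_zero y hy; field_simp

lemma inv_eq (h : IsConformal S g g' φ) {y : V} (hy : y ∈ S) (i j : Fin 4) :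
    inv g' y i j = (φ y ^ 2)⁻¹ * inv g y i j := by
  have h0 := h.ne_zero y hy
  have hinv : (Matrix.of (g' y))⁻¹ = (φ y ^ 2)⁻¹ • (Matrix.of (g y))⁻¹ := by
    apply Matrix.inv_eq_left_inv
    have : Matrix.of (g' y) = φ y ^ 2 • Matrix.of (g y) := by
      ext a b; simpa using h.eq y hy a b
    rw [this, Matrix.smul_mul, Matrix.mul_smul,
      Matrix.nonsing_inv_mul _ (h.metric.isUnit_det y hy), smul_smul,
      inv_mul_cancel₀ (pow_ne_zero 2 h0), one_smul]
  simp [inv, hinv]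

lemma trace_eq (h : IsConformal S g g' φ) {y : V} (hy : y ∈ S) (T : Comp2) :
    trace g' T y = (φ y ^ 2)⁻¹ * trace g T y := by
  simp_rw [trace, h.inv_eq hy, Finset.mul_sum, mul_assoc]

lemma differentiableAt (h : IsConformal S g g' φ) {E : Type*} [NormedAddCommGroup E]
    [NormedSpace ℝ E] {f : V → E} (hf : ContDiffOn ℝ ∞ f S) {y : V} (hy : y ∈ S) :
    DifferentiableAt ℝ f y :=
  (hf.contDiffAt (h.isOpen.mem_nhds hy)).differentiableAt (by simp)

lemma contDiffOn_logGrad (h : IsConformal S g g' φ) (i : Fin 4) :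
    ContDiffOn ℝ ∞ (logGrad φ i) S :=
  (h.smooth.inv h.ne_zero).mul (contDiffOn_pd h.isOpen h.smooth i)

lemma contDiffOn_logGradVec (h : IsConformal S g g' φ) (i : Fin 4) :
    ContDiffOn ℝ ∞ (logGradVec g φ i) S :=
  ContDiffOn.sum fun l _ => (h.metric.contDiffOn_inv i l).mul (h.contDiffOn_logGrad l)

lemma sum_metric_mul_logGradVec (h : IsConformal S g g' φ) {y : V} (hy : y ∈ S) (i : Fin 4) :
    ∑ k, g y i k * logGradVec g φ k y = logGrad φ i y := by
  simp_rw [logGradVec, Finset.mul_sum, ← mul_assoc]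
  rw [Finset.sum_comm]
  simp_rw [← Finset.sum_mul, h.metric.mul_inv hy]
  simp

lemma pd_logGrad (h : IsConformal S g g' φ) {y : V} (hy : y ∈ S) (i j : Fin 4) :
    pd i (logGrad φ j) y
      = (φ y)⁻¹ * pd i (pd j φ) y - logGrad φ i y * logGrad φ j y := by
  have h0 := h.ne_zero y hy
  have hφ := h.differentiableAt h.smooth hy
  unfold logGrad
  rw [pd_mul i (hφ.fun_inv h0) (h.differentiableAt (contDiffOn_pd h.isOpen h.smooth j) hy),
    show pd i (fun z => (φ z)⁻¹) y = _ from pd_inv i hφ h0]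
  field_simp
  ring

lemma christoffel_eq (h : IsConformal S g g' φ) {y : V} (hy : y ∈ S) (k i j : Fin 4) :
    christoffel g' y k i j = christoffel g y k i j + connectionDiff g φ y k i j := by
  have h0 := h.ne_zero y hy
  have hφ := h.differentiableAt h.smooth hy
  have hpd : ∀ a b c, pd a (fun z => g' z b c) y
      = 2 * φ y * pd a φ y * g y b c + φ y ^ 2 * pd a (fun z => g z b c) y := by
    intro a b c
    rw [pd_congr_of_isOpen h.isOpen (fun z hz => h.eq z hz b c) a hy,
      pd_mul a (hφ.fun_pow 2) (h.differentiableAt (h.metric.smooth b c) hy), pd_sq a hφ]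
  have hterm : ∀ l, inv g' y k l * (pd i (fun z => g' z j l) y + pd j (fun z => g' z i l) y
        - pd l (fun z => g' z i j) y)
      = inv g y k l * (pd i (fun z => g z j l) y + pd j (fun z => g z i l) y
        - pd l (fun z => g z i j) y) + 2 * ((inv g y k l * g y l j) * logGrad φ i y
        + (inv g y k l * g y l i) * logGrad φ j y - inv g y k l * logGrad φ l y * g y i j) := by
    intro l
    rw [hpd, hpd, hpd, h.inv_eq hy, h.metric.symm y hy j l, h.metric.symm y hy i l]
    simp only [logGrad]
    field_simp
    ring
  simp_rw [christoffel, hterm, Finset.sum_add_distrib, ← Finset.mul_sum, Finset.sum_sub_distrib,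
    Finset.sum_add_distrib, ← Finset.sum_mul, h.metric.inv_mul hy]
  simp only [connectionDiff, logGradVec]
  ring

lemma contDiffOn_connectionDiff (h : IsConformal S g g' φ) (k i j : Fin 4) :
    ContDiffOn ℝ ∞ (fun y => connectionDiff g φ y k i j) S :=
  ((contDiffOn_const.mul (h.contDiffOn_logGrad i)).add
    (contDiffOn_const.mul (h.contDiffOn_logGrad j))).sub
    ((h.contDiffOn_logGradVec k).mul (h.metric.smooth i j))

/-- The trace of `∇_i w_j` is the divergence `∂_k w^k + Γ^k_{km} w^m`. -/
lemma trace_logHess (h : IsConformal S g g' φ) {y : V} (hy : y ∈ S) :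
    trace g (logHess g φ) y = ∑ k, pd k (logGradVec g φ k) y
      + ∑ k, ∑ m, christoffel g y k k m * logGradVec g φ m y := by
  -- Differentiating `w_j = g_{jk} w^k` avoids the derivatives of the inverse metric.
  have hdiff : ∀ i j, pd i (logGrad φ j) y - ∑ m, christoffel g y m i j * logGrad φ m y
      = ∑ k, (g y j k * pd i (logGradVec g φ k) y
        + (∑ m, christoffel g y m i k * g y j m) * logGradVec g φ k y) := by
    intro i j
    rw [pd_congr_of_isOpen h.isOpen (fun z hz => (h.sum_metric_mul_logGradVec hz j).symm) i hy,
      pd_sum _ _ fun k _ => (h.differentiableAt (h.metric.smooth j k) hy).fun_mul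
        (h.differentiableAt (h.contDiffOn_logGradVec k) hy)]
    have h1 : ∑ m, christoffel g y m i j * logGrad φ m y
        = ∑ k, (∑ m, christoffel g y m i j * g y m k) * logGradVec g φ k y := by
      simp_rw [← h.sum_metric_mul_logGradVec hy, Finset.mul_sum, Finset.sum_mul]
      rw [Finset.sum_comm]
      simp_rw [mul_assoc]
    rw [h1, ← Finset.sum_sub_distrib]
    refine Finset.sum_congr rfl fun k _ => ?_
    rw [pd_mul i (h.differentiableAt (h.metric.smooth j k) hy)
        (h.differentiableAt (h.contDiffOn_logGradVec k) hy),
      h.metric.pd_metric h.isOpen hy, Finset.sum_add_distrib]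
    ring
  have hcontr : ∀ (i : Fin 4) (x : Fin 4 → ℝ),
      ∑ j, inv g y i j * ∑ k, g y j k * x k = x i := by
    intro i x
    simp_rw [Finset.mul_sum, ← mul_assoc]
    rw [Finset.sum_comm]
    simp_rw [← Finset.sum_mul, h.metric.inv_mul hy]
    simp
  simp_rw [trace, logHess, hdiff, Finset.sum_add_distrib, mul_add, Finset.sum_add_distrib, hcontr]
  congr 1
  refine Finset.sum_congr rfl fun i _ => ?_
  have h2 : ∀ j, ∑ k, (∑ m, christoffel g y m i k * g y j m) * logGradVec g φ k y
      = ∑ m, g y j m * ∑ k, christoffel g y m i k * logGradVec g φ k y := by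
    intro j
    simp_rw [Finset.mul_sum, Finset.sum_mul]
    rw [Finset.sum_comm]
    exact Finset.sum_congr rfl fun _ _ => Finset.sum_congr rfl fun _ _ => by ring
  simp_rw [h2]
  exact hcontr i fun m => ∑ k, christoffel g y m i k * logGradVec g φ k y

/-! ### The Ricci tensor -/

lemma pd_logGrad_symm (h : IsConformal S g g' φ) {y : V} (hy : y ∈ S) (i j : Fin 4) :
    pd i (logGrad φ j) y = pd j (logGrad φ i) y := by
  rw [h.pd_logGrad hy, h.pd_logGrad hy, pd_comm h.isOpen h.smooth hy, mul_comm (logGrad φ i y)]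

lemma sum_logGradVec_mul_metric (h : IsConformal S g g' φ) {y : V} (hy : y ∈ S) (i : Fin 4) :
    ∑ k, logGradVec g φ k y * g y k i = logGrad φ i y := by
  rw [← h.sum_metric_mul_logGradVec hy]
  exact Finset.sum_congr rfl fun k _ => by rw [h.metric.symm y hy k i, mul_comm]

lemma pd_connectionDiff (h : IsConformal S g g' φ) {y : V} (hy : y ∈ S) (a k i j : Fin 4) :
    pd a (fun z => connectionDiff g φ z k i j) y
      = (if k = j then 1 else 0) * pd a (logGrad φ i) y
        + (if k = i then 1 else 0) * pd a (logGrad φ j) y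
        - (pd a (logGradVec g φ k) y * g y i j
          + logGradVec g φ k y * pd a (fun z => g z i j) y) := by
  have hw := fun i => h.differentiableAt (h.contDiffOn_logGrad i) hy
  have hu := h.differentiableAt (h.contDiffOn_logGradVec k) hy
  have hg := h.differentiableAt (h.metric.smooth i j) hy
  unfold connectionDiff
  rw [pd_sub a (((hw i).const_mul _).fun_add ((hw j).const_mul _)) (hu.fun_mul hg),
    pd_add a ((hw i).const_mul _) ((hw j).const_mul _), pd_const_mul _ _ (hw i),
    pd_const_mul _ _ (hw j), pd_mul a hu hg]

lemma sum_pd_connectionDiff (h : IsConformal S g g' φ) {y : V} (hy : y ∈ S) (j l : Fin 4) :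
    ∑ k, pd k (fun z => connectionDiff g φ z k j l) y
      = 2 * pd j (logGrad φ l) y - (∑ k, pd k (logGradVec g φ k) y) * g y j l
        - ∑ k, logGradVec g φ k y * pd k (fun z => g z j l) y := by
  simp_rw [h.pd_connectionDiff hy, Finset.sum_sub_distrib, Finset.sum_add_distrib, Finset.sum_mul]
  simp only [ite_mul, one_mul, zero_mul, Finset.sum_ite_eq', Finset.mem_univ, if_true]
  rw [h.pd_logGrad_symm hy l j]
  ring

/-- The trace of the connection difference is `C^k_{kl} = 4 w_l`. -/
lemma sum_pd_connectionDiff_trace (h : IsConformal S g g' φ) {y : V} (hy : y ∈ S)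
    (j l : Fin 4) :
    ∑ k, pd j (fun z => connectionDiff g φ z k k l) y = 4 * pd j (logGrad φ l) y := by
  rw [← pd_sum _ _ fun k _ => h.differentiableAt (h.contDiffOn_connectionDiff k k l) hy,
    pd_congr_of_isOpen h.isOpen (f' := fun z => 4 * logGrad φ l z) _ j hy,
    pd_const_mul _ _ (h.differentiableAt (h.contDiffOn_logGrad l) hy)]
  intro z hz
  simp_rw [connectionDiff, Finset.sum_sub_distrib, Finset.sum_add_distrib,
    h.sum_logGradVec_mul_metric hz]
  simp

/-- The terms of the curvature that are linear in the difference of the connections.  The last two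
terms on the right cancel against derivative terms in the Ricci tensor. -/
lemma sum_christoffel_mul_connectionDiff (h : IsConformal S g g' φ) {y : V} (hy : y ∈ S)
    (j l : Fin 4) :
    ∑ k, ∑ m, (christoffel g y k k m * connectionDiff g φ y m j l
        + connectionDiff g φ y k k m * christoffel g y m j l
        - christoffel g y k j m * connectionDiff g φ y m k l
        - connectionDiff g φ y k j m * christoffel g y m k l)
      = 2 * ∑ m, christoffel g y m j l * logGrad φ m y
        - (∑ k, ∑ m, christoffel g y k k m * logGradVec g φ m y) * g y j l
        + ∑ k, logGradVec g φ k y * pd k (fun z => g z j l) y := by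
  have hsymm := h.metric.christoffel_symm h.isOpen hy
  have h1 : ∑ k, ∑ m, christoffel g y k k m * connectionDiff g φ y m j l
      = (∑ k, christoffel g y k k l) * logGrad φ j y + (∑ k, christoffel g y k k j) * logGrad φ l y
        - (∑ k, ∑ m, christoffel g y k k m * logGradVec g φ m y) * g y j l := by
    simp only [connectionDiff, mul_sub, mul_add, Finset.sum_sub_distrib, Finset.sum_add_distrib,
      ite_mul, one_mul, zero_mul, mul_ite, mul_zero, Finset.sum_ite_eq', Finset.mem_univ, if_true,
      Finset.sum_mul, mul_assoc]
  have h2 : ∑ k, ∑ m, connectionDiff g φ y k k m * christoffel g y m j l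
      = 4 * ∑ m, christoffel g y m j l * logGrad φ m y := by
    rw [Finset.sum_comm]
    simp_rw [← Finset.sum_mul, connectionDiff, Finset.sum_sub_distrib, Finset.sum_add_distrib,
      h.sum_logGradVec_mul_metric hy, Finset.mul_sum]
    refine Finset.sum_congr rfl fun m _ => ?_
    simp
    ring
  have h3 : ∑ k, ∑ m, christoffel g y k j m * connectionDiff g φ y m k l
      = ∑ m, christoffel g y m j l * logGrad φ m y + (∑ k, christoffel g y k k j) * logGrad φ l y
        - ∑ k, ∑ m, christoffel g y m k j * g y m l * logGradVec g φ k y := by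
    rw [Finset.sum_comm (f := fun k m => christoffel g y m k j * g y m l * logGradVec g φ k y)]
    simp only [connectionDiff, mul_sub, mul_add, Finset.sum_sub_distrib, Finset.sum_add_distrib,
      ite_mul, one_mul, zero_mul, mul_ite, mul_zero, Finset.sum_ite_eq', Finset.mem_univ, if_true,
      Finset.sum_mul]
    congr 1
    · congr 1
      exact Finset.sum_congr rfl fun k _ => by rw [hsymm k j k]
    · exact Finset.sum_congr rfl fun k _ => Finset.sum_congr rfl fun m _ => by
        rw [hsymm k j m]; ring
  have h4 : ∑ k, ∑ m, connectionDiff g φ y k j m * christoffel g y m k l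
      = (∑ k, christoffel g y k k l) * logGrad φ j y + ∑ m, christoffel g y m j l * logGrad φ m y
        - ∑ k, ∑ m, christoffel g y m k l * g y j m * logGradVec g φ k y := by
    simp only [connectionDiff, sub_mul, add_mul, Finset.sum_sub_distrib, Finset.sum_add_distrib,
      ite_mul, one_mul, zero_mul, Finset.sum_ite_eq, Finset.mem_univ, if_true, Finset.sum_mul]
    congr 1
    · congr 1
      · exact Finset.sum_congr rfl fun k _ => mul_comm _ _
      · rw [Finset.sum_comm]
        simp only [Finset.sum_ite_eq', Finset.mem_univ, if_true]
        exact Finset.sum_congr rfl fun k _ => mul_comm _ _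
    · exact Finset.sum_congr rfl fun k _ => Finset.sum_congr rfl fun m _ => by ring
  have h5 : ∑ k, logGradVec g φ k y * pd k (fun z => g z j l) y
      = ∑ k, ∑ m, christoffel g y m k j * g y m l * logGradVec g φ k y
        + ∑ k, ∑ m, christoffel g y m k l * g y j m * logGradVec g φ k y := by
    simp_rw [h.metric.pd_metric h.isOpen hy, ← Finset.sum_add_distrib, Finset.mul_sum]
    exact Finset.sum_congr rfl fun k _ => Finset.sum_congr rfl fun m _ => by ring
  simp_rw [Finset.sum_sub_distrib, Finset.sum_add_distrib, h1, h2, h3, h4, h5]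
  ring

/-- The terms of the curvature that are quadratic in the difference of the connections. -/
lemma sum_connectionDiff_mul_connectionDiff (h : IsConformal S g g' φ) {y : V} (hy : y ∈ S)
    (j l : Fin 4) :
    ∑ k, ∑ m, (connectionDiff g φ y k k m * connectionDiff g φ y m j l
        - connectionDiff g φ y k j m * connectionDiff g φ y m k l)
      = 2 * logGrad φ j y * logGrad φ l y
        - 2 * (∑ k, logGrad φ k y * logGradVec g φ k y) * g y j l := by
  have h1 := h.sum_logGradVec_mul_metric hy
  have h1' := h.sum_metric_mul_logGradVec hy
  have h2 : ∑ k, ∑ m, connectionDiff g φ y k k m * connectionDiff g φ y m j l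
      = 8 * logGrad φ j y * logGrad φ l y
        - 4 * (∑ k, logGrad φ k y * logGradVec g φ k y) * g y j l := by
    have ht : ∀ m, ∑ k, connectionDiff g φ y k k m = 4 * logGrad φ m y := by
      intro m
      simp_rw [connectionDiff, Finset.sum_sub_distrib, Finset.sum_add_distrib, h1]
      simp
    rw [Finset.sum_comm]
    simp_rw [← Finset.sum_mul, ht, connectionDiff, mul_sub, mul_add, Finset.sum_sub_distrib,
      Finset.sum_add_distrib]
    simp only [ite_mul, one_mul, zero_mul, mul_ite, mul_zero, Finset.sum_ite_eq', Finset.mem_univ,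
      if_true, Finset.sum_mul, Finset.mul_sum]
    congr 1
    · ring
    · exact Finset.sum_congr rfl fun k _ => by ring
  have h3 : ∀ k, ∑ m, connectionDiff g φ y k j m * connectionDiff g φ y m k l
      = (if k = j then 1 else 0) * ((∑ m, logGrad φ m y * logGradVec g φ m y) * (- g y k l)
          + 2 * logGrad φ k y * logGrad φ l y)
        + logGrad φ j y * ((if k = l then 1 else 0) * logGrad φ k y + logGrad φ l y
          - logGradVec g φ k y * g y k l)
        - logGradVec g φ k y * (logGrad φ k y * g y j l + g y j k * logGrad φ l y
          - logGrad φ j y * g y k l) := by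
    intro k
    have e : ∀ m, connectionDiff g φ y k j m * connectionDiff g φ y m k l
        = (if k = j then 1 else 0) * ((if m = l then 1 else 0) * (logGrad φ m y * logGrad φ k y)
            + (if m = k then 1 else 0) * (logGrad φ m y * logGrad φ l y)
            - logGrad φ m y * logGradVec g φ m y * g y k l)
          + logGrad φ j y * (if k = m then 1 else 0) * ((if m = l then 1 else 0) * logGrad φ k y
            + (if m = k then 1 else 0) * logGrad φ l y - logGradVec g φ m y * g y k l)
          - logGradVec g φ k y * ((if m = l then 1 else 0) * (logGrad φ k y * g y j m)
            + (if m = k then 1 else 0) * (logGrad φ l y * g y j m)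
            - g y j m * logGradVec g φ m y * g y k l) := by
      intro m
      simp only [connectionDiff]
      ring
    simp_rw [e, Finset.sum_sub_distrib, Finset.sum_add_distrib, ← Finset.mul_sum,
      Finset.sum_sub_distrib, Finset.sum_add_distrib, ← Finset.sum_mul, h1', mul_assoc,
      ← Finset.mul_sum]
    simp only [ite_mul, one_mul, zero_mul, Finset.sum_ite_eq', Finset.sum_ite_eq, Finset.mem_univ,
      if_true]
    congr 1
    · congr 1
      split_ifs <;> ring
    · ring
  have h4 : ∑ k, ∑ m, connectionDiff g φ y k j m * connectionDiff g φ y m k l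
      = 6 * logGrad φ j y * logGrad φ l y
        - 2 * (∑ k, logGrad φ k y * logGradVec g φ k y) * g y j l := by
    have e : ∀ k, logGradVec g φ k y * (logGrad φ k y * g y j l + g y j k * logGrad φ l y
          - logGrad φ j y * g y k l)
        = logGrad φ k y * logGradVec g φ k y * g y j l
          + g y j k * logGradVec g φ k y * logGrad φ l y
          - logGradVec g φ k y * g y k l * logGrad φ j y := fun k => by ring
    simp_rw [h3, e, Finset.sum_sub_distrib, Finset.sum_add_distrib, ← Finset.mul_sum,
      Finset.sum_sub_distrib, Finset.sum_add_distrib, ← Finset.sum_mul, h1, h1']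
    simp
    ring
  simp_rw [Finset.sum_sub_distrib, h2, h4]
  ring

/-- The change of the Ricci tensor under a conformal change of the metric in dimension four. -/
lemma ricci_eq (h : IsConformal S g g' φ) {y : V} (hy : y ∈ S) (j l : Fin 4) :
    ricci g' y j l = ricci g y j l - 2 * (logHess g φ y j l - logGrad φ j y * logGrad φ l y)
      - (trace g (logHess g φ) y + 2 * ∑ k, logGrad φ k y * logGradVec g φ k y) * g y j l := by
  have hpd : ∀ a k i j, pd a (fun z => christoffel g' z k i j) y
      = pd a (fun z => christoffel g z k i j) y
        + pd a (fun z => connectionDiff g φ z k i j) y := by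
    intro a k i j
    rw [pd_congr_of_isOpen h.isOpen (fun z hz => h.christoffel_eq hz k i j) a hy,
      pd_add a (h.differentiableAt (h.metric.contDiffOn_christoffel h.isOpen k i j) hy)
        (h.differentiableAt (h.contDiffOn_connectionDiff k i j) hy)]
  have hterm : ∀ k, riemann g' y k j k l = riemann g y k j k l
      + (pd k (fun z => connectionDiff g φ z k j l) y - pd j (fun z => connectionDiff g φ z k k l) y
      + ∑ m, (christoffel g y k k m * connectionDiff g φ y m j l
        + connectionDiff g φ y k k m * christoffel g y m j l
        - christoffel g y k j m * connectionDiff g φ y m k l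
        - connectionDiff g φ y k j m * christoffel g y m k l)
      + ∑ m, (connectionDiff g φ y k k m * connectionDiff g φ y m j l
        - connectionDiff g φ y k j m * connectionDiff g φ y m k l)) := by
    intro k
    have e : ∑ m, (christoffel g' y k k m * christoffel g' y m j l
          - christoffel g' y k j m * christoffel g' y m k l)
        = ∑ m, (christoffel g y k k m * christoffel g y m j l
          - christoffel g y k j m * christoffel g y m k l)
        + (∑ m, (christoffel g y k k m * connectionDiff g φ y m j l
          + connectionDiff g φ y k k m * christoffel g y m j l
          - christoffel g y k j m * connectionDiff g φ y m k l
          - connectionDiff g φ y k j m * christoffel g y m k l)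
        + ∑ m, (connectionDiff g φ y k k m * connectionDiff g φ y m j l
          - connectionDiff g φ y k j m * connectionDiff g φ y m k l)) := by
      rw [← Finset.sum_add_distrib, ← Finset.sum_add_distrib]
      refine Finset.sum_congr rfl fun m _ => ?_
      simp only [h.christoffel_eq hy]
      ring
    rw [riemann, riemann, hpd, hpd, e]
    ring
  simp_rw [ricci, hterm, Finset.sum_add_distrib, Finset.sum_sub_distrib (f := fun k =>
    pd k (fun z => connectionDiff g φ z k j l) y)]
  rw [h.sum_pd_connectionDiff hy, h.sum_pd_connectionDiff_trace hy,
    h.sum_christoffel_mul_connectionDiff hy, h.sum_connectionDiff_mul_connectionDiff hy,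
    h.trace_logHess hy, logHess]
  ring

end IsConformal

/-! ### Traces and the Schouten tensor -/

lemma trace_congr {g A B : Comp2} {y : V} (h : ∀ i j, A y i j = B y i j) :
    trace g A y = trace g B y := by
  simp_rw [trace, h]

lemma trace_add (g A B : Comp2) (y : V) :
    trace g (fun z i j => A z i j + B z i j) y = trace g A y + trace g B y := by
  simp_rw [trace, mul_add, Finset.sum_add_distrib]

lemma trace_const_mul (g A : Comp2) (c : ℝ) (y : V) :
    trace g (fun z i j => c * A z i j) y = c * trace g A y := by
  simp_rw [trace, Finset.mul_sum]
  exact Finset.sum_congr rfl fun i _ => Finset.sum_congr rfl fun j _ => by ring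

lemma trace_sub (g A B : Comp2) (y : V) :
    trace g (fun z i j => A z i j - B z i j) y = trace g A y - trace g B y := by
  simp_rw [trace, mul_sub, Finset.sum_sub_distrib]

lemma trace_sum {ι : Type*} (s : Finset ι) (g : Comp2) (A : ι → Comp2) (y : V) :
    trace g (fun z i j => ∑ a ∈ s, A a z i j) y = ∑ a ∈ s, trace g (A a) y := by
  simp_rw [trace, Finset.mul_sum]
  rw [Finset.sum_comm (s := s)]
  exact Finset.sum_congr rfl fun i _ => Finset.sum_comm

lemma IsMetricOn.trace_self {S : Set V} {g : Comp2} (hg : IsMetricOn S g) {y : V} (hy : y ∈ S) :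
    trace g g y = 4 := by
  have : ∀ i, ∑ j, inv g y i j * g y i j = 1 := by
    intro i
    simp_rw [hg.symm y hy i]
    simp [hg.inv_mul hy]
  simp [trace, this]

lemma IsMetricOn.trace_schouten {S : Set V} {g : Comp2} (hg : IsMetricOn S g) {y : V}
    (hy : y ∈ S) : trace g (schouten g) y = (1 / 6) * trace g (ricci g) y := by
  rw [trace_congr (B := fun z i j => (1 / 2) * (ricci g z i j
    - (1 / 6) * trace g (ricci g) y * g z i j)) fun i j => rfl]
  rw [trace_const_mul, trace_sub, trace_const_mul, hg.trace_self hy]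
  ring

lemma IsMetricOn.einstein_eq {S : Set V} {g : Comp2} (hg : IsMetricOn S g) {y : V} (hy : y ∈ S)
    (i j : Fin 4) :
    einstein g y i j = 2 * schouten g y i j - 2 * trace g (schouten g) y * g y i j := by
  rw [hg.trace_schouten hy, einstein, schouten]
  ring

lemma IsMetricOn.trace_einstein {S : Set V} {g : Comp2} (hg : IsMetricOn S g) {y : V}
    (hy : y ∈ S) : trace g (einstein g) y = -6 * trace g (schouten g) y := by
  rw [trace_congr (B := fun z i j => 2 * schouten g z i j - 2 * trace g (schouten g) y * g z i j)
    (hg.einstein_eq hy), trace_sub, trace_const_mul, trace_const_mul,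
    hg.trace_self hy]
  ring

namespace IsConformal

variable {S : Set V} {g g' : Comp2} {φ : V → ℝ}

lemma trace_logGrad_mul_logGrad (y : V) :
    trace g (fun z i j => logGrad φ i z * logGrad φ j z) y
      = ∑ k, logGrad φ k y * logGradVec g φ k y := by
  simp_rw [trace, logGradVec, Finset.mul_sum]
  exact Finset.sum_congr rfl fun i _ => Finset.sum_congr rfl fun j _ => by ring

/-- The change of the Schouten tensor under a conformal change of the metric. -/
lemma schouten_eq (h : IsConformal S g g' φ) {y : V} (hy : y ∈ S) (i j : Fin 4) :
    schouten g' y i j = schouten g y i j - logHess g φ y i j + logGrad φ i y * logGrad φ j y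
      - (1 / 2) * (∑ k, logGrad φ k y * logGradVec g φ k y) * g y i j := by
  have h0 := h.ne_zero y hy
  have htr : trace g (ricci g') y = trace g (ricci g) y - 6 * trace g (logHess g φ) y
      - 6 * ∑ k, logGrad φ k y * logGradVec g φ k y := by
    rw [trace_congr (B := fun z j l => ricci g z j l
        - 2 * (logHess g φ z j l - logGrad φ j z * logGrad φ l z)
        - (trace g (logHess g φ) y + 2 * ∑ k, logGrad φ k y * logGradVec g φ k y) * g z j l)
      (h.ricci_eq hy), trace_sub, trace_sub, trace_const_mul, trace_sub,
      trace_logGrad_mul_logGrad, trace_const_mul, h.metric.trace_self hy]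
    ring
  rw [schouten, h.trace_eq hy, htr, h.ricci_eq hy, h.eq y hy, schouten]
  field_simp
  ring

lemma logHess_eq (h : IsConformal S g g' φ) {y : V} (hy : y ∈ S) (i j : Fin 4) :
    logHess g φ y i j
      = (φ y)⁻¹ * hessian g φ y i j - logGrad φ i y * logGrad φ j y := by
  rw [logHess, h.pd_logGrad hy, hessian, mul_sub, Finset.mul_sum]
  have : ∀ k, christoffel g y k i j * logGrad φ k y
      = (φ y)⁻¹ * (christoffel g y k i j * pd k φ y) := fun k => by rw [logGrad]; ring
  simp_rw [this]
  change _ = (φ y)⁻¹ * pd i (pd j φ) y - _ - _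
  ring

lemma gradSq_eq (h : IsConformal S g g' φ) {y : V} (hy : y ∈ S) :
    gradSq g φ y = φ y ^ 2 * ∑ k, logGrad φ k y * logGradVec g φ k y := by
  have h0 := h.ne_zero y hy
  simp_rw [gradSq, logGradVec, logGrad, Finset.mul_sum]
  refine Finset.sum_congr rfl fun i _ => Finset.sum_congr rfl fun j _ => ?_
  field_simp

/-- Up to the quartic term, the energy-momentum tensor of a conformal scalar field is the Schouten
tensor of the dual metric. -/
lemma scalarD_eq (h : IsConformal S g g' φ) {y : V} (hy : y ∈ S) (μ : ℝ) (i j : Fin 4) :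
    scalarD g φ μ y i j = 2 * φ y ^ 2 * schouten g' y i j - 2 * μ * φ y ^ 4 * g y i j := by
  have h0 := h.ne_zero y hy
  rw [h.schouten_eq hy, h.logHess_eq hy, scalarD, h.gradSq_eq hy]
  have e : ∀ k, logGrad φ k y = (φ y)⁻¹ * pd k φ y := fun _ => rfl
  rw [e i, e j]
  field_simp
  ring

/-- The conformally invariant wave operator measures the Schouten scalar of the dual metric. -/
lemma wave_eq (h : IsConformal S g g' φ) {y : V} (hy : y ∈ S) :
    box g φ y - trace g (schouten g) y * φ y = -φ y ^ 3 * trace g' (schouten g') y := by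
  have h0 := h.ne_zero y hy
  rw [h.trace_eq hy, trace_congr (A := schouten g') (B := fun z i j => schouten g z i j
        - logHess g φ z i j + logGrad φ i z * logGrad φ j z
        - (1 / 2) * (∑ k, logGrad φ k y * logGradVec g φ k y) * g z i j) (h.schouten_eq hy),
    trace_sub, trace_add, trace_sub, trace_congr (A := logHess g φ) (B := fun z i j =>
      (φ y)⁻¹ * hessian g φ z i j - logGrad φ i z * logGrad φ j z) (h.logHess_eq hy),
    trace_sub, trace_const_mul, trace_const_mul,
    h.metric.trace_self hy, trace_logGrad_mul_logGrad, box]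
  field_simp
  ring

/-- The trace of the Einstein equations: the Schouten scalar is fixed by the cosmological constant,
because the scalar field and the matter `Q` have trace-free energy-momentum tensors. -/
lemma trace_schouten_of_einstein (h : IsConformal S g g' φ) {y : V} (hy : y ∈ S)
    {ε lam μ : ℝ} {Q : Comp2} (hQ : trace g Q y = 0)
    (hwave : box g φ y - trace g (schouten g) y * φ y = -4 * μ * φ y ^ 3)
    (hein : ∀ i j, einstein g y i j + 6 * lam * g y i j = ε * scalarD g φ μ y i j + Q y i j) :
    trace g (schouten g) y = 4 * lam := by
  have h0 := h.ne_zero y hy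
  have h1 : trace g' (schouten g') y = 4 * μ := by
    have := h.wave_eq hy
    rw [hwave] at this
    have h3 : φ y ^ 3 ≠ 0 := pow_ne_zero 3 h0
    apply mul_left_cancel₀ h3
    linarith
  have h2 : trace g (schouten g') y = φ y ^ 2 * (4 * μ) := by
    rw [← h1, h.trace_eq hy]
    field_simp
  have h3 := trace_congr (g := g) (A := fun z i j => einstein g z i j + 6 * lam * g z i j)
    (B := fun z i j => ε * (2 * φ y ^ 2 * schouten g' z i j - 2 * μ * φ y ^ 4 * g z i j) + Q z i j)
    (y := y) fun i j => by rw [hein, h.scalarD_eq hy]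
  rw [trace_add, trace_add, trace_const_mul, trace_const_mul, trace_sub, trace_const_mul,
    trace_const_mul, h.metric.trace_einstein hy, h.metric.trace_self hy, h2, hQ] at h3
  linarith

/-- The dual field satisfies the wave equation. -/
lemma dual_wave (h : IsConformal S g g' φ) {y : V} (hy : y ∈ S) {lam : ℝ}
    (htr : trace g (schouten g) y = 4 * lam) :
    box g' (fun z => 1 / φ z) y - trace g' (schouten g') y * (1 / φ y)
      = -4 * lam * (1 / φ y) ^ 3 := by
  rw [h.symm.wave_eq hy, htr]
  ring

/-- The dual metric satisfies the Einstein equations.  Both systems state that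
`2 L - 2 λ g` and `ε φ² (2 L' - 2 μ g')` differ by the matter terms. -/
lemma dual_einstein (h : IsConformal S g g' φ) {y : V} (hy : y ∈ S) {ε lam μ : ℝ}
    (hε : ε = 1 ∨ ε = -1) {Q Q' : Comp2} (hQ : trace g Q y = 0)
    (hwave : box g φ y - trace g (schouten g) y * φ y = -4 * μ * φ y ^ 3)
    (hein : ∀ i j, einstein g y i j + 6 * lam * g y i j = ε * scalarD g φ μ y i j + Q y i j)
    (hQ' : ∀ i j, Q' y i j = -ε * (1 / φ y ^ 2 * Q y i j)) (i j : Fin 4) :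
    einstein g' y i j + 6 * μ * g' y i j
      = ε * scalarD g' (fun z => 1 / φ z) lam y i j + Q' y i j := by
  have h0 := h.ne_zero y hy
  have htr := h.trace_schouten_of_einstein hy hQ hwave hein
  have htr' : trace g' (schouten g') y = 4 * μ := by
    have := h.wave_eq hy
    rw [hwave] at this
    apply mul_left_cancel₀ (pow_ne_zero 3 h0)
    linarith
  have he := hein i j
  rw [h.metric.einstein_eq hy, htr, h.scalarD_eq hy] at he
  rw [h.metric'.einstein_eq hy, htr', h.symm.scalarD_eq hy, hQ', h.eq y hy,
    show Q y i j = _ from (sub_eq_iff_eq_add'.2 he).symm]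
  have hε2 : ε ^ 2 = 1 := by rcases hε with rfl | rfl <;> norm_num
  field_simp
  linear_combination (-2 * φ y ^ 2 * schouten g' y i j + 2 * μ * φ y ^ 4 * g y i j) * hε2

end IsConformal

/-! ### Divergences -/

section Divergence

namespace IsConformal

variable {S : Set V} {g g' : Comp2} {φ : V → ℝ} {E : Type*} [NormedAddCommGroup E]
  [NormedSpace ℝ E]

lemma sum_inv_mul_logGrad (h : IsConformal S g g' φ) {y : V} (hy : y ∈ S) (i : Fin 4) :
    ∑ k, inv g y k i * logGrad φ k y = logGradVec g φ i y := by
  simp_rw [logGradVec, h.metric.inv_symm hy _ i]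

lemma sum_connectionDiff_smul_left (y : V) (k i j : Fin 4) (T : V → Fin 4 → Fin 4 → E) :
    ∑ m, connectionDiff g φ y m k i • T y m j
      = logGrad φ k y • T y i j + logGrad φ i y • T y k j
        - g y k i • ∑ m, logGradVec g φ m y • T y m j := by
  simp [connectionDiff, sub_smul, add_smul, Finset.sum_sub_distrib, Finset.sum_add_distrib,
    ite_smul, Finset.smul_sum, smul_smul, mul_comm]

/-- The change of the divergence of a two-tensor under a conformal change of the metric in
dimension four. -/
lemma divergence_eq (h : IsConformal S g g' φ) {y : V} (hy : y ∈ S)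
    (T : V → Fin 4 → Fin 4 → E) (j : Fin 4) :
    φ y ^ 2 • divergence g' T y j = divergence g T y j
      + ∑ m, logGradVec g φ m y • (T y m j + T y j m)
      - logGrad φ j y • ∑ k, ∑ i, inv g y k i • T y k i := by
  have h0 := h.ne_zero y hy
  set X : Fin 4 → E := fun j => ∑ m, logGradVec g φ m y • T y m j with hX
  set Y : Fin 4 → E := fun j => ∑ m, logGradVec g φ m y • T y j m with hY
  have hcov : ∀ k i, covDeriv g' T y k i j = covDeriv g T y k i j
      - ((logGrad φ k y • T y i j + logGrad φ i y • T y k j - g y k i • X j)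
        + (logGrad φ k y • T y i j + logGrad φ j y • T y i k - g y k j • Y i)) := by
    intro k i
    have hl := sum_connectionDiff_smul_left (g := g) (φ := φ) y k i j T
    have hr := sum_connectionDiff_smul_left (g := g) (φ := φ) y k j i (fun z a b => T z b a)
    simp only [covDeriv, h.christoffel_eq hy, add_smul, Finset.sum_add_distrib]
    rw [hl, hr]
    simp only [hX, hY]
    abel
  have hdiv : φ y ^ 2 • divergence g' T y j = ∑ k, ∑ i, inv g y k i • covDeriv g' T y k i j := by
    simp_rw [divergence, h.inv_eq hy, Finset.smul_sum, smul_smul,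
      mul_inv_cancel_left₀ (pow_ne_zero 2 h0)]
  have hinv := h.metric.inv_symm hy
  have e1 : ∑ k, ∑ i, inv g y k i • logGrad φ k y • T y i j = X j := by
    rw [Finset.sum_comm]
    simp_rw [smul_smul, ← Finset.sum_smul, h.sum_inv_mul_logGrad hy, hX]
  have e2 : ∑ k, ∑ i, inv g y k i • logGrad φ i y • T y k j = X j := by
    simp_rw [smul_smul, ← Finset.sum_smul, hX, logGradVec]
  have e3 : ∑ k, ∑ i, inv g y k i • g y k i • X j = (4 : ℝ) • X j := by
    have : ∑ k, ∑ i, inv g y k i * g y k i = 4 := h.metric.trace_self hy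
    simp_rw [smul_smul, ← Finset.sum_smul, this]
  have e4 : ∑ k, ∑ i, inv g y k i • logGrad φ j y • T y i k
      = logGrad φ j y • ∑ k, ∑ i, inv g y k i • T y k i := by
    rw [Finset.sum_comm]
    simp_rw [Finset.smul_sum, hinv, smul_comm (logGrad φ j y)]
  have e5 : ∑ k, ∑ i, inv g y k i • g y k j • Y i = Y j := by
    rw [Finset.sum_comm]
    simp_rw [smul_smul, ← Finset.sum_smul, fun i k => hinv k i, h.metric.inv_mul hy]
    simp
  rw [hdiv]
  simp only [hcov, smul_sub, smul_add, Finset.sum_sub_distrib, Finset.sum_add_distrib,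
    e1, e2, e3, e4, e5, divergence]
  change _ = _ + (X j + Y j) - _
  module

/-- The divergence of a two-form is conformally invariant in dimension four. -/
lemma divergence_eq_of_antisymm (h : IsConformal S g g' φ) {y : V} (hy : y ∈ S)
    {T : V → Fin 4 → Fin 4 → E} (hT : ∀ i j, T y i j = -T y j i) (j : Fin 4) :
    divergence g' T y j = (φ y ^ 2)⁻¹ • divergence g T y j := by
  have h0 := h.ne_zero y hy
  have ht : ∑ k, ∑ i, inv g y k i • T y k i = 0 := by
    have : ∑ k, ∑ i, inv g y k i • T y k i = -∑ k, ∑ i, inv g y k i • T y k i := by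
      conv_lhs => rw [Finset.sum_comm]
      simp_rw [← Finset.sum_neg_distrib, ← smul_neg]
      refine Finset.sum_congr rfl fun i _ => Finset.sum_congr rfl fun k _ => ?_
      rw [h.metric.inv_symm hy, hT k i]
    have h2 : (2 : ℝ) • ∑ k, ∑ i, inv g y k i • T y k i = 0 := by
      rw [two_smul]
      exact eq_neg_iff_add_eq_zero.1 this
    exact (smul_eq_zero.1 h2).resolve_left two_ne_zero
  have hs : ∀ m, T y m j + T y j m = 0 := fun m => by rw [hT m j]; simp
  have := h.divergence_eq hy T j
  simp only [ht, hs, smul_zero, Finset.sum_const_zero, add_zero, sub_zero] at this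
  rw [← this, smul_smul, inv_mul_cancel₀ (pow_ne_zero 2 h0), one_smul]

/-- Trace-free symmetric divergence-free tensors of conformal weight `-2` remain divergence-free. -/
lemma divergence_conformal_weight (h : IsConformal S g g' φ) {y : V} (hy : y ∈ S) {T T' : Comp2}
    (hsmooth : ∀ i j, ContDiffOn ℝ ∞ (fun z => T z i j) S) (hT : ∀ i j, T y i j = T y j i)
    (htr : trace g T y = 0) (hT' : ∀ z ∈ S, ∀ i j, T' z i j = (φ z ^ 2)⁻¹ * T z i j) (j : Fin 4)
    (hdiv : divergence g T y j = 0) : divergence g' T' y j = 0 := by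
  have h0 := h.ne_zero y hy
  have hφ := h.differentiableAt h.smooth hy
  have hcov : ∀ k i, covDeriv g T' y k i j
      = (φ y ^ 2)⁻¹ * (covDeriv g T y k i j - 2 * logGrad φ k y * T y i j) := by
    intro k i
    have hpd : pd k (fun z => T' z i j) y
        = (φ y ^ 2)⁻¹ * (pd k (fun z => T z i j) y - 2 * logGrad φ k y * T y i j) := by
      rw [pd_congr_of_isOpen h.isOpen (fun z hz => hT' z hz i j) k hy,
        pd_mul k ((hφ.fun_pow 2).fun_inv (pow_ne_zero 2 h0))
          (h.differentiableAt (hsmooth i j) hy),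
        pd_inv k (hφ.fun_pow 2) (pow_ne_zero 2 h0), pd_sq k hφ, logGrad]
      field_simp
      ring
    have hsum : ∑ m, (christoffel g y m k i • T' y m j + christoffel g y m k j • T' y i m)
        = (φ y ^ 2)⁻¹ * ∑ m, (christoffel g y m k i • T y m j
          + christoffel g y m k j • T y i m) := by
      rw [Finset.mul_sum]
      refine Finset.sum_congr rfl fun m _ => ?_
      simp only [hT' y hy, smul_eq_mul]
      ring
    rw [covDeriv, hpd, hsum, covDeriv]
    ring
  have hdiv' : divergence g T' y j
      = (φ y ^ 2)⁻¹ * (divergence g T y j - 2 * ∑ m, logGradVec g φ m y * T y m j) := by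
    have e : ∑ m, logGradVec g φ m y * T y m j
        = ∑ k, ∑ i, inv g y k i * (logGrad φ k y * T y i j) := by
      rw [Finset.sum_comm]
      simp_rw [← mul_assoc, ← Finset.sum_mul, h.sum_inv_mul_logGrad hy]
    simp_rw [e, divergence, smul_eq_mul, hcov, Finset.mul_sum, ← Finset.sum_sub_distrib,
      Finset.mul_sum]
    exact Finset.sum_congr rfl fun k _ => Finset.sum_congr rfl fun i _ => by ring
  have hsum : ∑ m, logGradVec g φ m y • (T' y m j + T' y j m)
      = (φ y ^ 2)⁻¹ * (2 * ∑ m, logGradVec g φ m y * T y m j) := by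
    rw [Finset.mul_sum, Finset.mul_sum]
    refine Finset.sum_congr rfl fun m _ => ?_
    rw [hT' y hy, hT' y hy, hT j m, smul_eq_mul]
    ring
  have htr' : ∑ k, ∑ i, inv g y k i • T' y k i = 0 := by
    have : ∑ k, ∑ i, inv g y k i • T' y k i = (φ y ^ 2)⁻¹ * trace g T y := by
      simp_rw [trace, Finset.mul_sum, hT' y hy, smul_eq_mul]
      exact Finset.sum_congr rfl fun k _ => Finset.sum_congr rfl fun i _ => by ring
    rw [this, htr, mul_zero]
  have key := h.divergence_eq hy T' j
  rw [hdiv', hsum, htr', hdiv] at key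
  have : φ y ^ 2 • divergence g' T' y j = 0 := by rw [key]; simp
  exact (smul_eq_zero.1 this).resolve_left (pow_ne_zero 2 h0)

end IsConformal

end Divergence

/-! ### The conformal change on the manifold -/

lemma chartImage_mono {M : Type*} [TopologicalSpace M] (e : OpenPartialHomeomorph M V)
    {U U' : Set M} (h : U ⊆ U') : chartImage e U ⊆ chartImage e U' := fun _ hy => ⟨hy.1, h hy.2⟩

lemma isOpen_chartImage {M : Type*} [TopologicalSpace M] (e : OpenPartialHomeomorph M V)
    {U : Set M} (hU : IsOpen U) : IsOpen (chartImage e U) := e.isOpen_inter_preimage_symm hU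

section Manifold

variable {M : Type*} [TopologicalSpace M] [ChartedSpace V M]

lemma comp2_smul (e : OpenPartialHomeomorph M V) (c : M → ℝ) (T : Tensor2 M) (y : V)
    (i j : Fin 4) : comp2 e (fun x => c x • T x) y i j = rep e c y * comp2 e T y i j := rfl

lemma compVec_smul (e : OpenPartialHomeomorph M V) (c : M → ℝ) (v : VectorField M) (y : V)
    (i : Fin 4) : compVec e (fun x => c x • v x) y i = rep e c y * compVec e v y i := by
  simp [compVec, rep]

lemma isOpen_ne_zero [IsManifold (𝓡 4) ∞ M] {U : Set M} (hU : IsOpen U) {φ : M → ℝ}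
    (hφ : SmoothFun U φ) : IsOpen {x ∈ U | φ x ≠ 0} := by
  refine isOpen_iff_mem_nhds.2 fun x hx => ?_
  set e := chartAt V x with he
  have hxe : x ∈ e.source := mem_chart_source V x
  have hmem : e x ∈ chartImage e U :=
    ⟨e.map_source hxe, by simpa [e.left_inv hxe] using hx.1⟩
  have hcont : ContinuousAt (rep e φ) (e x) :=
    ((hφ e (IsManifold.chart_mem_maximalAtlas x)).continuousOn.continuousAt
      ((isOpen_chartImage e hU).mem_nhds hmem))
  have h0 : rep e φ (e x) ≠ 0 := by simpa [rep, e.left_inv hxe] using hx.2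
  have hev := (e.continuousAt hxe).eventually (hcont.eventually_ne h0)
  filter_upwards [hev, e.open_source.mem_nhds hxe, hU.mem_nhds hx.1] with z hz hze hzU
  exact ⟨hzU, by simpa [rep, e.left_inv hze] using hz⟩

lemma IsLorentzMetric.isMetricOn {U : Set M} {g : Tensor2 M} (hg : IsLorentzMetric U g)
    {e : OpenPartialHomeomorph M V} (he : IsChart e) :
    IsMetricOn (chartImage e U) (comp2 e g) where
  smooth := hg.1 e he
  symm y hy i j := by
    obtain ⟨P, -, hP⟩ := hg.2 e he y hy
    have ht : (Matrix.of (comp2 e g y))ᵀ = Matrix.of (comp2 e g y) := by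
      rw [hP]
      simp [Matrix.transpose_mul, Matrix.mul_assoc, eta]
    simpa using congrFun (congrFun ht j) i
  isUnit_det y hy := by
    obtain ⟨P, hu, hP⟩ := hg.2 e he y hy
    rw [hP, Matrix.det_mul, Matrix.det_mul, Matrix.det_transpose]
    refine (hu.mul ?_).mul hu
    simp [eta, Matrix.det_diagonal, Fin.prod_univ_four]

lemma IsOrthonormalCoframe.smul {g g' : Comp2} {y : V} {P : Matrix (Fin 4) (Fin 4) ℝ}
    (hP : IsOrthonormalCoframe g y P) {c : ℝ} (hc : c ≠ 0)
    (hg : ∀ i j, g' y i j = c ^ 2 * g y i j) : IsOrthonormalCoframe g' y (c • P) := by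
  refine ⟨?_, ?_⟩
  · rw [Matrix.det_smul]
    exact ((isUnit_iff_ne_zero.2 hc).pow _).mul hP.1
  · have : Matrix.of (g' y) = c ^ 2 • Matrix.of (g y) := by
      ext i j; simpa using hg i j
    rw [this, hP.2]
    simp [smul_smul, sq]

lemma SmoothFun.mono {U U' : Set M} {f : M → ℝ} (hf : SmoothFun U f) (h : U' ⊆ U) :
    SmoothFun U' f := fun e he => (hf e he).mono (chartImage_mono e h)

lemma SmoothFun.mul {U : Set M} {f f' : M → ℝ} (hf : SmoothFun U f) (hf' : SmoothFun U f') :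
    SmoothFun U (fun x => f x * f' x) := fun e he => (hf e he).mul (hf' e he)

lemma SmoothFun.pow {U : Set M} {f : M → ℝ} (hf : SmoothFun U f) (n : ℕ) :
    SmoothFun U (fun x => f x ^ n) := fun e he => (hf e he).pow n

lemma SmoothFun.inv {U : Set M} {f : M → ℝ} (hf : SmoothFun U f) (h0 : ∀ x ∈ U, f x ≠ 0) :
    SmoothFun U (fun x => (f x)⁻¹) := fun e he => (hf e he).inv fun _ hy => h0 _ hy.2

lemma SmoothTensor2.mono {U U' : Set M} {T : Tensor2 M} (hT : SmoothTensor2 U T) (h : U' ⊆ U) :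
    SmoothTensor2 U' T := fun e he i j => (hT e he i j).mono (chartImage_mono e h)

lemma SmoothTensor2.smul {U : Set M} {f : M → ℝ} {T : Tensor2 M} (hf : SmoothFun U f)
    (hT : SmoothTensor2 U T) : SmoothTensor2 U (fun x => f x • T x) :=
  fun e he i j => (hf e he).mul (hT e he i j)

lemma IsLorentzMetric.mono {U U' : Set M} {g : Tensor2 M} (hg : IsLorentzMetric U g)
    (h : U' ⊆ U) : IsLorentzMetric U' g :=
  ⟨hg.1.mono h, fun e he y hy => hg.2 e he y (chartImage_mono e h hy)⟩

lemma IsLorentzMetric.conformal {U : Set M} {g : Tensor2 M} (hg : IsLorentzMetric U g)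
    {φ : M → ℝ} (hφ : SmoothFun U φ) (h0 : ∀ x ∈ U, φ x ≠ 0) :
    IsLorentzMetric U (fun x => φ x ^ 2 • g x) := by
  refine ⟨SmoothTensor2.smul (hφ.pow 2) hg.1, fun e he y hy => ?_⟩
  obtain ⟨P, hP⟩ := hg.2 e he y hy
  exact ⟨rep e φ y • P, hP.smul (h0 _ hy.2) fun i j => rfl⟩

lemma IsLorentzMetric.isConformal {U : Set M} {g : Tensor2 M} (hU : IsOpen U)
    (hg : IsLorentzMetric U g) {φ : M → ℝ} (hφ : SmoothFun U φ) (h0 : ∀ x ∈ U, φ x ≠ 0)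
    {e : OpenPartialHomeomorph M V} (he : IsChart e) :
    IsConformal (chartImage e U) (comp2 e g) (comp2 e (fun x => φ x ^ 2 • g x)) (rep e φ) where
  isOpen := isOpen_chartImage e hU
  metric := hg.isMetricOn he
  metric' := (hg.conformal hφ h0).isMetricOn he
  smooth := hφ e he
  ne_zero _ hy := h0 _ hy.2
  eq _ _ _ _ := rfl

end Manifold

/-! ### Conformal invariance of trace-free matter -/

section Matter

variable {M : Type*} [TopologicalSpace M] [ChartedSpace V M]

/-- The matter fields for the metric `φ² g`: Maxwell and Yang-Mills fields, null covectors and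
distribution functions on the cotangent bundle are unchanged, velocities have weight `-1`, and the
densities are scaled so that the energy-momentum tensor acquires the factor `φ⁻²`. -/
def dualField (φ : M → ℝ) : (t : MatterType) → MatterField M t → MatterField M t
  | .maxwell, F => F
  | .yangMills _, W => W
  | .radiationFluid, (m : FluidField M) =>
      (⟨fun x => (φ x ^ 4)⁻¹ * m.ρ x, fun x => (φ x)⁻¹ • m.u x⟩ : FluidField M)
  | .nullFluid, (m : NullFluidField M) =>
      (⟨fun x => (φ x ^ 2)⁻¹ * m.ρ x, m.k⟩ : NullFluidField M)
  | .masslessVlasov, f => f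
  | .other, m => m

variable {U : Set M} {g T : Tensor2 M} {φ : M → ℝ}

lemma MaxwellEquations.conformal (hU : IsOpen U) (hg : IsLorentzMetric U g)
    (hφ : SmoothFun U φ) (h0 : ∀ x ∈ U, φ x ≠ 0) {F : Tensor2 M} (h : MaxwellEquations U g F T) :
    MaxwellEquations U (fun x => φ x ^ 2 • g x) F (fun x => (1 / φ x ^ 2) • T x) := by
  refine ⟨h.1, fun e he y hy => ?_⟩
  have hc := hg.isConformal hU hφ h0 he
  have hy0 := hc.ne_zero y hy
  obtain ⟨hanti, hclosed, hdiv, hT⟩ := h.2 e he y hy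
  refine ⟨hanti, hclosed, fun j => ?_, fun i j => ?_⟩
  · rw [hc.divergence_eq_of_antisymm hy hanti, hdiv, smul_zero]
  · rw [comp2_smul, hT, hc.eq y hy, mul_add]
    simp_rw [hc.inv_eq hy, Finset.mul_sum]
    congr 1
    · refine Finset.sum_congr rfl fun l _ => Finset.sum_congr rfl fun m _ => ?_
      simp only [rep] at hy0 ⊢
      field_simp
    · refine Finset.sum_congr rfl fun k _ => Finset.sum_congr rfl fun l _ =>
        Finset.sum_congr rfl fun m _ => Finset.sum_congr rfl fun n _ => ?_
      simp only [rep] at hy0 ⊢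
      field_simp

lemma YangMillsField.strength_antisymm {𝒢 : GaugeGroup} (W : YangMillsField M 𝒢)
    (e : OpenPartialHomeomorph M V) (x : M) (y : V) (i j : Fin 4) :
    W.strength e x y i j = -W.strength e x y j i := by
  unfold YangMillsField.strength
  abel

lemma YangMillsEquations.conformal (hU : IsOpen U) (hg : IsLorentzMetric U g)
    (hφ : SmoothFun U φ) (h0 : ∀ x ∈ U, φ x ≠ 0) {𝒢 : GaugeGroup} {W : YangMillsField M 𝒢}
    (h : YangMillsEquations U g W T) :
    YangMillsEquations U (fun x => φ x ^ 2 • g x) W (fun x => (1 / φ x ^ 2) • T x) := by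
  refine ⟨h.1, fun x hx e he y hy => ?_⟩
  have hc := hg.isConformal hU hφ h0 he
  have hyU : y ∈ chartImage e U := chartImage_mono e Set.inter_subset_right hy
  have hy0 := hc.ne_zero y hyU
  obtain ⟨hdiv, hT⟩ := h.2 x hx e he y hy
  refine ⟨fun j => ?_, fun i j => ?_⟩
  · have hd : divMat (comp2 e fun x => φ x ^ 2 • g x) (W.strength e x) y j
        = (rep e φ y ^ 2)⁻¹ • divMat (comp2 e g) (W.strength e x) y j := by
      ext a b
      exact hc.divergence_eq_of_antisymm hyU (T := fun z k l => W.strength e x z k l a b)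
        (fun k l => by rw [W.strength_antisymm e x y k l]; rfl) j
    simp_rw [hd, hc.inv_eq hyU, mul_smul, ← Finset.smul_sum, ← smul_add, hdiv, smul_zero]
  · rw [comp2_smul, hT, hc.eq y hyU, mul_add]
    simp_rw [hc.inv_eq hyU, Finset.mul_sum]
    congr 1
    · refine Finset.sum_congr rfl fun l _ => Finset.sum_congr rfl fun m _ => ?_
      simp only [rep] at hy0 ⊢
      field_simp
    · refine Finset.sum_congr rfl fun k _ => Finset.sum_congr rfl fun l _ =>
        Finset.sum_congr rfl fun m _ => Finset.sum_congr rfl fun n _ => ?_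
      simp only [rep] at hy0 ⊢
      field_simp

lemma RadiationFluidEquations.conformal (hφ : SmoothFun U φ) (h0 : ∀ x ∈ U, φ x ≠ 0)
    {m : FluidField M} (h : RadiationFluidEquations U g m T) :
    RadiationFluidEquations U (fun x => φ x ^ 2 • g x) (dualField φ .radiationFluid m)
      (fun x => (1 / φ x ^ 2) • T x) := by
  obtain ⟨hρ, hu, hx⟩ := h
  refine ⟨((hφ.pow 4).inv fun x hx => pow_ne_zero 4 (h0 x hx)).mul hρ, fun e he i => ?_,
    fun x hxU => ?_⟩
  · exact ((hφ.inv h0 e he).mul (hu e he i)).congr fun y _ =>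
      compVec_smul e (fun x => (φ x)⁻¹) m.u y i
  · have hx0 := h0 x hxU
    obtain ⟨hpos, hunit, hT⟩ := hx x hxU
    refine ⟨mul_nonneg (by positivity) hpos, ?_, fun v w => ?_⟩
    · simp [dualField, hunit]
      field_simp
    · simp [dualField, hT]
      field_simp

lemma NullFluidEquations.conformal (hU : IsOpen U) (hg : IsLorentzMetric U g)
    (hφ : SmoothFun U φ) (h0 : ∀ x ∈ U, φ x ≠ 0) {m : NullFluidField M}
    (h : NullFluidEquations U g m T) :
    NullFluidEquations U (fun x => φ x ^ 2 • g x) (dualField φ .nullFluid m)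
      (fun x => (1 / φ x ^ 2) • T x) := by
  obtain ⟨hρ, hk, hnull, hx⟩ := h
  refine ⟨((hφ.pow 2).inv fun x hx => pow_ne_zero 2 (h0 x hx)).mul hρ, hk,
    fun e he y hy => ?_, fun x hxU => ?_⟩
  · have hc := hg.isConformal hU hφ h0 he
    change ∑ i, ∑ j, _ * compCovec e m.k y i * compCovec e m.k y j = 0
    have := hnull e he y hy
    simp_rw [mul_assoc] at this
    simp_rw [hc.inv_eq hy, mul_assoc, ← Finset.mul_sum (a := (rep e φ y ^ 2)⁻¹), this, mul_zero]
  · have hx0 := h0 x hxU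
    obtain ⟨hpos, hne, hT⟩ := hx x hxU
    refine ⟨mul_nonneg (by positivity) hpos, hne, fun v w => ?_⟩
    simp [dualField, hT]
    ring

lemma nullMomentum_smul (P : Matrix (Fin 4) (Fin 4) ℝ) (σ : ℝ) {c : ℝ} (hc : 0 < c)
    (q : EuclideanSpace ℝ (Fin 3)) :
    nullMomentum P σ q = nullMomentum (c⁻¹ • P) σ (c • q) := by
  have h0 := hc.ne'
  ext i
  simp only [nullMomentum, norm_smul, Real.norm_eq_abs, abs_of_pos hc, Matrix.smul_apply,
    smul_eq_mul, PiLp.smul_apply]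
  congr 1
  · field_simp
  · exact Finset.sum_congr rfl fun a _ => by field_simp

lemma VlasovEquations.conformal (hU : IsOpen U) (hg : IsLorentzMetric U g)
    (hφ : SmoothFun U φ) (h0 : ∀ x ∈ U, φ x ≠ 0)
    {f : ∀ x : M, (TangentSpace (𝓡 4) x →ₗ[ℝ] ℝ) → ℝ} (h : VlasovEquations U g f T) :
    VlasovEquations U (fun x => φ x ^ 2 • g x) f (fun x => (1 / φ x ^ 2) • T x) := by
  refine ⟨h.1, fun e he => ⟨(h.2 e he).1, fun y hy => ?_⟩⟩
  have hc := hg.isConformal hU hφ h0 he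
  have hy0 := hc.ne_zero y hy
  obtain ⟨hliouville, hmoment⟩ := (h.2 e he).2 y hy
  refine ⟨fun p hp hnull => ?_, fun P hP => ?_⟩
  · have hnull' : ∑ i, ∑ j, inv (comp2 e g) y i j * p i * p j = 0 := by
      simp_rw [hc.inv_eq hy, mul_assoc, ← Finset.mul_sum] at hnull
      have := (mul_eq_zero.1 hnull).resolve_left (inv_ne_zero (pow_ne_zero 2 hy0))
      simpa only [Finset.mul_sum, mul_assoc] using this
    have hpd : ∀ k i j, pd k (fun z => inv (comp2 e fun x => φ x ^ 2 • g x) z i j) y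
        = pd k (fun z => (rep e φ z ^ 2)⁻¹) y * inv (comp2 e g) y i j
          + (rep e φ y ^ 2)⁻¹ * pd k (fun z => inv (comp2 e g) z i j) y := by
      intro k i j
      rw [pd_congr_of_isOpen hc.isOpen (fun z hz => hc.inv_eq hz i j) k hy,
        pd_mul k (((hc.differentiableAt hc.smooth hy).fun_pow 2).fun_inv (pow_ne_zero 2 hy0))
          (hc.differentiableAt (hc.metric.contDiffOn_inv i j) hy)]
    -- The derivative of the conformal factor multiplies `g^{ij} p_i p_j`, which vanishes.
    have h2 : ∀ k, ∑ i, ∑ j, pd k (fun z => inv (comp2 e fun x => φ x ^ 2 • g x) z i j) y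
          * p i * p j * pd k (fun q => phaseRep e f y q) p
        = (rep e φ y ^ 2)⁻¹ * ∑ i, ∑ j, pd k (fun z => inv (comp2 e g) z i j) y
          * p i * p j * pd k (fun q => phaseRep e f y q) p := by
      intro k
      have : ∑ i, ∑ j, pd k (fun z => inv (comp2 e fun x => φ x ^ 2 • g x) z i j) y
            * p i * p j * pd k (fun q => phaseRep e f y q) p
          = pd k (fun z => (rep e φ z ^ 2)⁻¹) y * pd k (fun q => phaseRep e f y q) p
              * (∑ i, ∑ j, inv (comp2 e g) y i j * p i * p j)
            + (rep e φ y ^ 2)⁻¹ * ∑ i, ∑ j, pd k (fun z => inv (comp2 e g) z i j) y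
              * p i * p j * pd k (fun q => phaseRep e f y q) p := by
        simp_rw [Finset.mul_sum, ← Finset.sum_add_distrib]
        refine Finset.sum_congr rfl fun i _ => Finset.sum_congr rfl fun j _ => ?_
        rw [hpd]
        ring
      rw [this, hnull', mul_zero, zero_add]
    have h1 : ∑ i, ∑ j, inv (comp2 e fun x => φ x ^ 2 • g x) y i j * p j
          * pd i (fun z => phaseRep e f z p) y
        = (rep e φ y ^ 2)⁻¹ * ∑ i, ∑ j, inv (comp2 e g) y i j * p j
          * pd i (fun z => phaseRep e f z p) y := by
      simp_rw [hc.inv_eq hy, Finset.mul_sum, mul_assoc]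
    have := hliouville p hp hnull'
    simp_rw [h2, h1, ← Finset.mul_sum]
    rw [mul_left_comm, ← mul_sub, this, mul_zero]
  · set c := |rep e φ y| with hcdef
    have hc0 : 0 < c := abs_pos.2 hy0
    have hcsq : c ^ 2 = rep e φ y ^ 2 := sq_abs _
    have hP' : IsOrthonormalCoframe (comp2 e g) y (c⁻¹ • P) := by
      refine hP.smul (inv_ne_zero hc0.ne') fun i j => ?_
      rw [hc.eq y hy, inv_pow, hcsq]
      field_simp
    obtain ⟨hint, hT⟩ := hmoment _ hP'
    -- The null momenta of the two coframes correspond to each other under `q ↦ c q`.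
    have hmom : ∀ σ q, nullMomentum P σ q = nullMomentum (c⁻¹ • P) σ (c • q) :=
      fun σ q => nullMomentum_smul P σ hc0 q
    have hnorm : ∀ q : EuclideanSpace ℝ (Fin 3), ‖c • q‖ = c * ‖q‖ := fun q => by
      rw [norm_smul, Real.norm_eq_abs, abs_of_pos hc0]
    refine ⟨fun σ hσ => ?_, fun i j => ?_⟩
    · refine (((hint σ hσ).comp_smul hc0.ne').const_mul c⁻¹).congr (Filter.Eventually.of_forall
        fun q => ?_)
      simp only [hmom σ q, hnorm]
      field_simp
    · rw [comp2_smul, hT]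
      set G : EuclideanSpace ℝ (Fin 3) → ℝ := fun q =>
        (phaseRep e f y (nullMomentum (c⁻¹ • P) 1 q) * nullMomentum (c⁻¹ • P) 1 q i
            * nullMomentum (c⁻¹ • P) 1 q j
          + phaseRep e f y (nullMomentum (c⁻¹ • P) (-1) q) * nullMomentum (c⁻¹ • P) (-1) q i
            * nullMomentum (c⁻¹ • P) (-1) q j) / ‖q‖ with hG
      have hint' : ∀ q, (phaseRep e f y (nullMomentum P 1 q) * nullMomentum P 1 q i
            * nullMomentum P 1 q j
          + phaseRep e f y (nullMomentum P (-1) q) * nullMomentum P (-1) q i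
            * nullMomentum P (-1) q j) / ‖q‖ = c * G (c • q) := by
        intro q
        simp only [hG, hmom, hnorm]
        field_simp
      simp_rw [hint']
      rw [MeasureTheory.integral_const_mul, MeasureTheory.Measure.integral_comp_smul]
      have hr : rep e (fun x => 1 / φ x ^ 2) y = (c ^ 2)⁻¹ := by
        rw [hcsq, ← one_div]; rfl
      rw [hr, finrank_euclideanSpace_fin, abs_of_pos (by positivity), smul_eq_mul, ← mul_assoc]
      congr 1
      field_simp

lemma YangMillsField.IsConnection.mono {𝒢 : GaugeGroup} {W : YangMillsField M 𝒢}
    (h : W.IsConnection U) {U' : Set M} (hU' : U' ⊆ U) : W.IsConnection U' where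
  isOpen_patch x hx := h.isOpen_patch x (hU' hx)
  mem_patch x hx := h.mem_patch x (hU' hx)
  smooth_A x hx e he i a b := (h.smooth_A x (hU' hx) e he i a b).mono
    (chartImage_mono e (Set.inter_subset_inter_right _ hU'))
  A_mem x hx z hz := h.A_mem x (hU' hx) z (Set.inter_subset_inter_right _ hU' hz)
  smooth_γ x hx x' hx' e he a b := (h.smooth_γ x (hU' hx) x' (hU' hx') e he a b).mono
    (chartImage_mono e (Set.inter_subset_inter_right _ hU'))
  γ_mem x hx x' hx' z hz :=
    h.γ_mem x (hU' hx) x' (hU' hx') z (Set.inter_subset_inter_right _ hU' hz)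
  cocycle x hx x' hx' x'' hx'' z hz :=
    h.cocycle x (hU' hx) x' (hU' hx') x'' (hU' hx'') z (Set.inter_subset_inter_right _ hU' hz)
  gauge x hx x' hx' e he y hy := h.gauge x (hU' hx) x' (hU' hx') e he y
    (chartImage_mono e (Set.inter_subset_inter_right _ hU') hy)

lemma TypeEquations.mono {U' : Set M} (hU' : U' ⊆ U) :
    ∀ (t : MatterType) (m : MatterField M t), TypeEquations U g T t m → TypeEquations U' g T t m
  | .maxwell, _, h =>
    ⟨h.1.mono hU', fun e he y hy => h.2 e he y (chartImage_mono e hU' hy)⟩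
  | .yangMills _, _, h => ⟨h.1.mono hU', fun x hx e he y hy => h.2 x (hU' hx) e he y
      (chartImage_mono e (Set.inter_subset_inter_right _ hU') hy)⟩
  | .radiationFluid, _, h => ⟨h.1.mono hU',
      fun e he i => (h.2.1 e he i).mono (chartImage_mono e hU'), fun x hx => h.2.2 x (hU' hx)⟩
  | .nullFluid, _, h => ⟨h.1.mono hU', fun e he i => (h.2.1 e he i).mono (chartImage_mono e hU'),
      fun e he y hy => h.2.2.1 e he y (chartImage_mono e hU' hy),
      fun x hx => h.2.2.2 x (hU' hx)⟩
  | .masslessVlasov, _, h => ⟨fun x hx => h.1 x (hU' hx), fun e he =>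
      ⟨(h.2 e he).1.mono fun _ hz => ⟨chartImage_mono e hU' hz.1, hz.2⟩,
        fun y hy => (h.2 e he).2 y (chartImage_mono e hU' hy)⟩⟩
  | .other, _, _ => trivial

lemma IsTraceFreeMatter.mono {t : MatterType} {m : MatterField M t}
    (h : IsTraceFreeMatter U g t m T) {U' : Set M} (hU' : U' ⊆ U) :
    IsTraceFreeMatter U' g t m T where
  smooth := h.smooth.mono hU'
  symm x hx := h.symm x (hU' hx)
  traceFree e he y hy := h.traceFree e he y (chartImage_mono e hU' hy)
  divFree e he y hy := h.divFree e he y (chartImage_mono e hU' hy)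
  equations := TypeEquations.mono hU' t m h.equations

/-- Conformal invariance of trace-free matter in dimension four. -/
lemma IsTraceFreeMatter.conformal (hU : IsOpen U) (hg : IsLorentzMetric U g)
    (hφ : SmoothFun U φ) (h0 : ∀ x ∈ U, φ x ≠ 0) {t : MatterType} {m : MatterField M t}
    (h : IsTraceFreeMatter U g t m T) :
    IsTraceFreeMatter U (fun x => φ x ^ 2 • g x) t (dualField φ t m)
      (fun x => (1 / φ x ^ 2) • T x) where
  smooth := by
    simp_rw [one_div]
    exact SmoothTensor2.smul ((hφ.pow 2).inv fun x hx => pow_ne_zero 2 (h0 x hx)) h.smooth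
  symm x hx v w := by simp [h.symm x hx v w]
  traceFree e he y hy := by
    rw [(hg.isConformal hU hφ h0 he).trace_eq hy, trace_congr
      (B := fun z i j => rep e (fun x => 1 / φ x ^ 2) y * comp2 e T z i j) fun i j => rfl,
      trace_const_mul, h.traceFree e he y hy, mul_zero, mul_zero]
  divFree e he y hy j :=
    (hg.isConformal hU hφ h0 he).divergence_conformal_weight hy (h.smooth e he)
      (fun _ _ => h.symm _ hy.2 _ _) (h.traceFree e he y hy)
      (fun z _ i j => by rw [comp2_smul, ← one_div]; rfl) j (h.divFree e he y hy j)
  equations := by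
    have := h.equations
    match t, m, this with
    | .maxwell, _, h => exact MaxwellEquations.conformal hU hg hφ h0 h
    | .yangMills _, _, h => exact YangMillsEquations.conformal hU hg hφ h0 h
    | .radiationFluid, _, h => exact RadiationFluidEquations.conformal hφ h0 h
    | .nullFluid, _, h => exact NullFluidEquations.conformal hU hg hφ h0 h
    | .masslessVlasov, _, h => exact VlasovEquations.conformal hU hg hφ h0 h
    | .other, _, _ => exact trivial

end Matter

/-! ### Attractive and repulsive matter -/

/-- The character of the matter in the dual solution: reversed for `ε = 1`, kept for `ε = -1`. -/
def Character.dual (ε : ℝ) : Character → Character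
  | .attractive => if ε = 1 then .repulsive else .attractive
  | .repulsive => if ε = 1 then .attractive else .repulsive

lemma Character.sign_dual {ε : ℝ} (hε : ε = 1 ∨ ε = -1) (χ : Character) :
    (χ.dual ε).sign = -ε * χ.sign := by
  rcases hε with rfl | rfl <;> cases χ <;> norm_num [Character.dual, Character.sign]

end ConformalDuality

end

open ConformalDuality
theorem mainTheorem1 {M : Type*} [TopologicalSpace M]
    [ChartedSpace (EuclideanSpace ℝ (Fin 4)) M] [IsManifold (𝓡 4) ∞ M]
    {ι : Type*} [Fintype ι] (U : Set M) (g : Tensor2 M) (φ : M → ℝ) (ε lam μ : ℝ)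
    (τ : ι → MatterType) (m : ∀ a, MatterField M (τ a)) (T : ι → Tensor2 M) (χ : ι → Character)
    (h : IsSolution U g φ ε (6 * lam) μ τ m T χ) :
    ∃ (m' : ∀ a, MatterField M (τ a)) (T' : ι → Tensor2 M) (χ' : ι → Character),
      IsSolution {x ∈ U | φ x ≠ 0} (fun x => φ x ^ 2 • g x) (fun x => 1 / φ x) ε (6 * μ) lam
        τ m' T' χ' ∧
      (∀ a, ∀ x ∈ U, φ x ≠ 0 → T' a x = (1 / φ x ^ 2) • T a x) ∧
      (ε = 1 → ∀ a, (χ a = .repulsive → χ' a = .attractive) ∧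
        (χ a = .attractive → χ' a = .repulsive)) ∧
      (ε = -1 → ∀ a, χ' a = χ a) := by
  have hsub : {x ∈ U | φ x ≠ 0} ⊆ U := fun x hx => hx.1
  have h0 : ∀ x ∈ {x ∈ U | φ x ≠ 0}, φ x ≠ 0 := fun x hx => hx.2
  have hopen := isOpen_ne_zero h.isOpen h.smooth_field
  have hφ := h.smooth_field.mono hsub
  have hg := h.metric.mono hsub
  have hmatter := fun a => (h.matter a).mono hsub
  have hQ : ∀ e, IsChart e → ∀ y ∈ chartImage e {x ∈ U | φ x ≠ 0},
      trace (comp2 e g) (fun z i j => ∑ a, (χ a).sign * comp2 e (T a) z i j) y = 0 := by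
    intro e he y hy
    rw [trace_sum Finset.univ _ fun a z i j => (χ a).sign * comp2 e (T a) z i j]
    refine Finset.sum_eq_zero fun a _ => ?_
    rw [trace_const_mul, (hmatter a).traceFree e he y hy, mul_zero]
  refine ⟨fun a => dualField φ (τ a) (m a), fun a x => (1 / φ x ^ 2) • T a x,
    fun a => (χ a).dual ε, ⟨hopen, hg.conformal hφ h0, ?_, h.param, ?_,
      fun a => (hmatter a).conformal hopen hg hφ h0, ?_⟩, fun _ _ _ _ => rfl, ?_, ?_⟩
  · simp_rw [one_div]
    exact hφ.inv h0
  · intro e he y hy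
    have hc := hg.isConformal hopen hφ h0 he
    have hyU := chartImage_mono e hsub hy
    exact hc.dual_wave hy (hc.trace_schouten_of_einstein hy (hQ e he y hy) (h.wave e he y hyU)
      (h.einstein_eq e he y hyU))
  · intro e he y hy
    have hyU := chartImage_mono e hsub hy
    refine (hg.isConformal hopen hφ h0 he).dual_einstein hy h.param (hQ e he y hy)
      (h.wave e he y hyU) (h.einstein_eq e he y hyU)
      (Q' := fun z i j => ∑ a, ((χ a).dual ε).sign
        * comp2 e (fun x => (1 / φ x ^ 2) • T a x) z i j) fun i j => ?_
    simp_rw [Finset.mul_sum, Character.sign_dual h.param]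
    refine Finset.sum_congr rfl fun a _ => ?_
    rw [comp2_smul e (fun x => 1 / φ x ^ 2)]
    simp only [rep]
    ring
  · rintro rfl a
    exact ⟨fun ha => by simp [ha, Character.dual], fun ha => by simp [ha, Character.dual]⟩
  · rintro rfl a
    cases ha : χ a <;> norm_num [ha, Character.dual]
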